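/- Proposition 4.5. All super Lie and super $L_\infty$-algebras are real, of finite type and concentrated in non-negative degrees; each is given by its Chevalley–Eilenberg algebra $\mathrm{CE}(\mathfrak g)$, a differential $d$ of bidegree $(1,\mathrm{even})$ on the free $(\mathbb Z\times\mathbb Z_2)$-graded-commutative algebra on $\mathfrak g[1]^*$ (exchanging elements of bidegrees $(n,\sigma)$ and $(n',\sigma')$ gives the sign $(-1)^{nn'+\sigma\sigma'}$). A morphism $\mathfrak g\to\mathfrak h$ is a morphism $\mathrm{CE}(\mathfrak h)\to\mathrm{CE}(\mathfrak g)$ of differential bigraded algebras. Weak equivalences are the morphisms whose linear part is a quasi-isomorphism, and fibrations those whose linear part is surjective in positive degrees. The homotopy fiber of $f:\mathfrak g\to\mathfrak h$ is, up to weak equivalence over $\mathfrak g$, the pullback along $f$ of a fibration $E\to\mathfrak h$ with $0\to E$ a weak equivalence. Let $\mathbb R[n]$ be the algebra whose $\mathrm{CE}$ is free on one closed even generator of degree $n+1$; a closed even element $\mu\in\mathrm{CE}(\mathfrak g)$ of degree $n+1$ is the same as a morphism $\mu:\mathfrak g\to\mathbb R[n]$. For real $N\times N$ matrices $\Gamma^a$,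 $a=1,\dots,d$, with $\Gamma^a\Gamma^b+\Gamma^b\Gamma^a=2\eta^{ab}$, $\eta=\mathrm{diag}(-1,1,\dots,1)$, and an invertible $C$ with $C^{T}=-C$ and $(C\Gamma^a)^{T}=C\Gamma^a$, write $\overline\psi=\psi^{T}C$ and let the super-Minkowski algebra be given by generators $e^a$ of bidegree $(1,\mathrm{even})$ and $\psi^\alpha$ of bidegree $(1,\mathrm{odd})$ with $$d e^a=\overline\psi\wedge\Gamma^a\psi,\qquad d\psi^\alpha=0 .$$ For $d=10$ and $N=32$ (the representation $\mathbf{16}\oplus\mathbf{16}'$) it is denoted $\mathbb R^{10;N=(1,1)}$, and for $d=11$ and $N=32$ (the representation $\mathbf{32}$) it is denoted $\mathbb R^{11;N=1}$. Let $\Gamma^{11}:=\Gamma^1\Gamma^2\cdots\Gamma^{10}$ be the chirality operator in dimension $10$. Then, for every choice of such data $(\Gamma,C)$ in dimension $10$ and every choice of such data in dimension $11$, the element $\mu=\overline\psi\wedge\Gamma^{11}\psi\in\mathrm{CE}(\mathbb R^{10;N=(1,1)})$ is a 2-cocycle, and there is a morphism $\mathbb R^{11;N=1}\to\mathbb R^{10;N=(1,1)}$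 that exhibits $\mathbb R^{11;N=1}$ as the homotopy fiber of $\mu:\mathbb R^{10;N=(1,1)}\to\mathbb R[1]$, that is, as the extension of $\mathbb R^{10;N=(1,1)}$ classified by $\mu$. -/

import Mathlib

open CategoryTheory

namespace SuperLInfinity

noncomputable section

/-! ## Free graded-commutative superalgebras -/

/-- The sign picked up when elements of bidegrees `m` and `n` in `ℤ × ℤ/2` are exchanged:
`(-1)^(deg · deg + parity · parity)`. -/
def koszulSign (m n : ℕ × ZMod 2) : ℝ :=
  (-1) ^ (m.1 * n.1 + m.2.val * n.2.val)

/-- The relations `x y = ± y x` between generators. -/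
inductive CommRel {X : Type} (deg : X → ℕ × ZMod 2) :
    FreeAlgebra ℝ X → FreeAlgebra ℝ X → Prop
  | swap (x y : X) : CommRel deg (FreeAlgebra.ι ℝ x * FreeAlgebra.ι ℝ y)
      (koszulSign (deg x) (deg y) • (FreeAlgebra.ι ℝ y * FreeAlgebra.ι ℝ x))

/-- The free graded-commutative real superalgebra on generators `x : X` of bidegree `deg x`. -/
def FreeSuperComm {X : Type} (deg : X → ℕ × ZMod 2) : Type :=
  RingQuot (CommRel deg)

instance {X : Type} (deg : X → ℕ × ZMod 2) : Ring (FreeSuperComm deg) :=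
  inferInstanceAs (Ring (RingQuot (CommRel deg)))

instance {X : Type} (deg : X → ℕ × ZMod 2) : Algebra ℝ (FreeSuperComm deg) :=
  inferInstanceAs (Algebra ℝ (RingQuot (CommRel deg)))

namespace FreeSuperComm

variable {X : Type} {deg : X → ℕ × ZMod 2}

/-- The quotient map. -/
def mk (deg : X → ℕ × ZMod 2) : FreeAlgebra ℝ X →ₐ[ℝ] FreeSuperComm deg :=
  RingQuot.mkAlgHom ℝ (CommRel deg)

/-- The generator `x`. -/
def gen (deg : X → ℕ × ZMod 2) (x : X) : FreeSuperComm deg :=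
  mk deg (FreeAlgebra.ι ℝ x)

/-- The subspace of elements of bidegree `n`: spanned by the words in the generators of total
bidegree `n`. -/
def homog (deg : X → ℕ × ZMod 2) (n : ℕ × ZMod 2) : Submodule ℝ (FreeSuperComm deg) :=
  Submodule.span ℝ {a | ∃ l : List X, (l.map deg).sum = n ∧ (l.map (gen deg)).prod = a}

/-- The universal property: a map on generators whose values commute up to the Koszul sign
extends to an algebra homomorphism. -/
def lift {B : Type} [Ring B] [Algebra ℝ B] (f : X → B)
    (hf : ∀ x y, f x * f y = koszulSign (deg x) (deg y) • (f y * f x)) :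
    FreeSuperComm deg →ₐ[ℝ] B :=
  RingQuot.liftAlgHom ℝ ⟨FreeAlgebra.lift ℝ f, by
    rintro _ _ ⟨x, y⟩
    simpa using hf x y⟩

@[simp] theorem lift_gen {B : Type} [Ring B] [Algebra ℝ B] (f : X → B)
    (hf : ∀ x y, f x * f y = koszulSign (deg x) (deg y) • (f y * f x)) (x : X) :
    lift f hf (gen deg x) = f x := by
  unfold lift gen mk
  erw [RingQuot.liftAlgHom_mkAlgHom_apply]
  simp

theorem gen_mul_gen (x y : X) :
    gen deg x * gen deg y = koszulSign (deg x) (deg y) • (gen deg y * gen deg x) := by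
  have h : mk deg _ = mk deg _ := RingQuot.mkAlgHom_rel ℝ (CommRel.swap (deg := deg) x y)
  rw [map_mul, map_smul, map_mul] at h
  exact h

theorem neg_one_pow_val (a b c : ZMod 2) :
    ((-1 : ℝ)) ^ ((a + b).val * c.val) = (-1) ^ (a.val * c.val) * (-1) ^ (b.val * c.val) := by
  have : ∀ a b c : ZMod 2, ((-1 : ℤ)) ^ ((a + b).val * c.val)
      = (-1) ^ (a.val * c.val) * (-1) ^ (b.val * c.val) := by decide
  exact_mod_cast this a b c

theorem koszulSign_add_left (m m' n : ℕ × ZMod 2) :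
    koszulSign (m + m') n = koszulSign m n * koszulSign m' n := by
  simp only [koszulSign, Prod.fst_add, Prod.snd_add, pow_add, neg_one_pow_val, add_mul]
  ring

theorem koszulSign_comm (m n : ℕ × ZMod 2) : koszulSign m n = koszulSign n m := by
  simp only [koszulSign, mul_comm]

theorem koszulSign_zero_left (n : ℕ × ZMod 2) : koszulSign 0 n = 1 := by
  simp [koszulSign]

theorem koszulSign_add_right (m n n' : ℕ × ZMod 2) :
    koszulSign m (n + n') = koszulSign m n * koszulSign m n' := by
  rw [koszulSign_comm, koszulSign_add_left, koszulSign_comm n, koszulSign_comm n']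

theorem word_mem (l : List X) : (l.map (gen deg)).prod ∈ homog deg (l.map deg).sum :=
  Submodule.subset_span ⟨l, rfl, rfl⟩

theorem gen_mem (x : X) : gen deg x ∈ homog deg (deg x) := by
  simpa using word_mem (deg := deg) [x]

theorem one_mem_homog : (1 : FreeSuperComm deg) ∈ homog deg 0 := by
  simpa using word_mem (deg := deg) []

theorem mul_mem_homog {m n : ℕ × ZMod 2} {a b : FreeSuperComm deg}
    (ha : a ∈ homog deg m) (hb : b ∈ homog deg n) : a * b ∈ homog deg (m + n) := by
  induction ha using Submodule.span_induction with
  | zero => simp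
  | add x y _ _ hx hy => rw [add_mul]; exact add_mem hx hy
  | smul r x _ hx => rw [smul_mul_assoc]; exact Submodule.smul_mem _ _ hx
  | mem x hx =>
    obtain ⟨l, rfl, rfl⟩ := hx
    induction hb using Submodule.span_induction with
    | zero => simp
    | add x y _ _ hx hy => rw [mul_add]; exact add_mem hx hy
    | smul r x _ hx => rw [mul_smul_comm]; exact Submodule.smul_mem _ _ hx
    | mem x hx =>
      obtain ⟨k, rfl, rfl⟩ := hx
      simpa using word_mem (deg := deg) (l ++ k)

theorem gen_mul_word (x : X) (l : List X) :
    gen deg x * (l.map (gen deg)).prod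
      = koszulSign (deg x) (l.map deg).sum • ((l.map (gen deg)).prod * gen deg x) := by
  induction l with
  | nil => simp [koszulSign]
  | cons y l ih =>
    simp only [List.map_cons, List.prod_cons, List.sum_cons]
    rw [← mul_assoc, gen_mul_gen, smul_mul_assoc, mul_assoc, ih, mul_smul_comm, smul_smul,
      koszulSign_add_right, mul_assoc]

theorem word_mul_word (k l : List X) :
    (k.map (gen deg)).prod * (l.map (gen deg)).prod
      = koszulSign (k.map deg).sum (l.map deg).sum •
        ((l.map (gen deg)).prod * (k.map (gen deg)).prod) := by
  induction k with
  | nil => simp [koszulSign]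
  | cons y k ih =>
    simp only [List.map_cons, List.prod_cons, List.sum_cons]
    rw [mul_assoc, ih, mul_smul_comm, ← mul_assoc, gen_mul_word, smul_mul_assoc, smul_smul,
      koszulSign_add_left, mul_assoc, mul_comm (koszulSign (deg y) _)]

/-- Homogeneous elements commute up to the Koszul sign. -/
theorem homog_mul_comm {m n : ℕ × ZMod 2} {a b : FreeSuperComm deg}
    (ha : a ∈ homog deg m) (hb : b ∈ homog deg n) : a * b = koszulSign m n • (b * a) := by
  induction ha using Submodule.span_induction with
  | zero => simp
  | add x y _ _ hx hy => rw [add_mul, hx, hy, mul_add, smul_add]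
  | smul r x _ hx => rw [smul_mul_assoc, hx, mul_smul_comm, smul_comm]
  | mem x hx =>
    obtain ⟨l, rfl, rfl⟩ := hx
    induction hb using Submodule.span_induction with
    | zero => simp
    | add x y _ _ hx hy => rw [mul_add, hx, hy, add_mul, smul_add]
    | smul r x _ hx => rw [mul_smul_comm, hx, smul_mul_assoc, smul_comm]
    | mem x hx =>
      obtain ⟨k, rfl, rfl⟩ := hx
      exact word_mul_word l k

/-- Every element is a linear combination of words. -/
theorem span_words :
    Submodule.span ℝ (Set.range fun l : List X => (l.map (gen deg)).prod) = ⊤ := by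
  rw [eq_top_iff]
  rintro a -
  obtain ⟨a, rfl⟩ : ∃ b, mk deg b = a := RingQuot.mkAlgHom_surjective ℝ (CommRel deg) a
  induction a using FreeAlgebra.induction with
  | grade0 r =>
    rw [AlgHom.commutes, Algebra.algebraMap_eq_smul_one]
    exact Submodule.smul_mem _ _ (Submodule.subset_span ⟨[], rfl⟩)
  | grade1 x => exact Submodule.subset_span ⟨[x], by simp [gen]⟩
  | add a b ha hb => rw [map_add]; exact add_mem ha hb
  | mul a b ha hb =>
    rw [map_mul]
    have := Submodule.mul_mem_mul ha hb
    erw [Submodule.span_mul_span] at this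
    refine Submodule.span_mono ?_ this
    rintro _ ⟨_, ⟨l, rfl⟩, _, ⟨k, rfl⟩, rfl⟩
    exact ⟨l ++ k, by simp⟩

/-- The grading involution `a ↦ (-1)^n a` on elements of cohomological degree `n`. -/
def invol (deg : X → ℕ × ZMod 2) : FreeSuperComm deg →ₐ[ℝ] FreeSuperComm deg :=
  lift (fun x => (-1 : ℝ) ^ (deg x).1 • gen deg x) fun x y => by
    rw [smul_mul_smul_comm, smul_mul_smul_comm, gen_mul_gen x y, smul_comm (koszulSign _ _),
      mul_comm ((-1 : ℝ) ^ _)]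

theorem invol_of_mem {n : ℕ × ZMod 2} {a : FreeSuperComm deg} (ha : a ∈ homog deg n) :
    invol deg a = (-1 : ℝ) ^ n.1 • a := by
  induction ha using Submodule.span_induction with
  | zero => simp
  | add x y _ _ hx hy => rw [map_add, hx, hy, smul_add]
  | smul r x _ hx => rw [map_smul, hx, smul_comm]
  | mem x hx =>
    obtain ⟨l, rfl, rfl⟩ := hx
    induction l with
    | nil => simp
    | cons y l ih =>
      simp only [List.map_cons, List.prod_cons, List.sum_cons, map_mul, ih, Prod.fst_add, pow_add]
      rw [invol, lift_gen, smul_mul_smul_comm]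

theorem derivation_rel (D : X → FreeSuperComm deg)
    (hD : ∀ x, D x ∈ homog deg ((deg x).1 + 1, (deg x).2)) (x y : X) :
    (!![invol deg (gen deg x), D x; 0, gen deg x] : Matrix (Fin 2) (Fin 2) (FreeSuperComm deg))
        * !![invol deg (gen deg y), D y; 0, gen deg y]
      = koszulSign (deg x) (deg y) • (!![invol deg (gen deg y), D y; 0, gen deg y]
        * !![invol deg (gen deg x), D x; 0, gen deg x]) := by
  have h1 : invol deg (gen deg x) * invol deg (gen deg y)
      = koszulSign (deg x) (deg y) • (invol deg (gen deg y) * invol deg (gen deg x)) := by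
    rw [← map_mul, gen_mul_gen, map_smul, map_mul]
  have h2 : invol deg (gen deg x) * D y + D x * gen deg y
      = koszulSign (deg x) (deg y) •
        (invol deg (gen deg y) * D x + D y * gen deg x) := by
    rw [invol_of_mem (gen_mem x), invol_of_mem (gen_mem y), smul_mul_assoc, smul_mul_assoc,
      homog_mul_comm (gen_mem x) (hD y), homog_mul_comm (hD x) (gen_mem y), smul_add, smul_smul,
      smul_smul, add_comm]
    congr 1
    · congr 1
      simp only [koszulSign, pow_add, add_mul, one_mul]
      ring
    · congr 1
      simp only [koszulSign, pow_add, mul_add, mul_one]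
      have : ((-1 : ℝ) ^ (deg x).1) * (-1 : ℝ) ^ (deg x).1 = 1 := by
        rw [← mul_pow]; simp
      linear_combination
        ((-1 : ℝ) ^ ((deg x).1 * (deg y).1) * (-1) ^ ((deg x).2.val * (deg y).2.val)) * this
  ext i j
  fin_cases i <;> fin_cases j
  · simpa [Matrix.mul_apply, Fin.sum_univ_two] using h1
  · simpa [Matrix.mul_apply, Fin.sum_univ_two] using h2
  · simp [Matrix.mul_apply, Fin.sum_univ_two]
  · simpa [Matrix.mul_apply, Fin.sum_univ_two] using gen_mul_gen x y

/-- The homomorphism `a ↦ (±a, d a; 0, a)` into upper triangular matrices that encodes the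
graded derivation with prescribed values `D x` on the generators. -/
def derivationAux (D : X → FreeSuperComm deg)
    (hD : ∀ x, D x ∈ homog deg ((deg x).1 + 1, (deg x).2)) :
    FreeSuperComm deg →ₐ[ℝ] Matrix (Fin 2) (Fin 2) (FreeSuperComm deg) :=
  lift (fun x => !![invol deg (gen deg x), D x; 0, gen deg x]) (derivation_rel D hD)

/-- The graded derivation of bidegree `(1, even)` with prescribed values on the generators. -/
def derivation (D : X → FreeSuperComm deg)
    (hD : ∀ x, D x ∈ homog deg ((deg x).1 + 1, (deg x).2)) :
    FreeSuperComm deg →ₗ[ℝ] FreeSuperComm deg where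
  toFun a := derivationAux D hD a 0 1
  map_add' a b := by simp
  map_smul' r a := by simp

section derivation

variable (D : X → FreeSuperComm deg)
  (hD : ∀ x, D x ∈ homog deg ((deg x).1 + 1, (deg x).2))

@[simp] theorem derivation_gen (x : X) : derivation D hD (gen deg x) = D x := by
  simp [derivation, derivationAux]

theorem derivationAux_entries (a : FreeSuperComm deg) :
    derivationAux D hD a 0 0 = invol deg a ∧ derivationAux D hD a 1 0 = 0 ∧
      derivationAux D hD a 1 1 = a := by
  have ha : a ∈ Submodule.span ℝ (Set.range fun l : List X => (l.map (gen deg)).prod) := by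
    rw [span_words]; trivial
  induction ha using Submodule.span_induction with
  | zero => simp
  | add x y _ _ hx hy => simp [hx, hy]
  | smul r x _ hx => simp [hx]
  | mem x hx =>
    obtain ⟨l, rfl⟩ := hx
    induction l with
    | nil => simp
    | cons y l ih =>
      have hy : derivationAux D hD (gen deg y)
          = !![invol deg (gen deg y), D y; 0, gen deg y] := by simp [derivationAux]
      simp only at ih
      simp [Matrix.mul_apply, Fin.sum_univ_two, hy, ih]

theorem derivation_mul' (a b : FreeSuperComm deg) :
    derivation D hD (a * b) = derivation D hD a * b + invol deg a * derivation D hD b := by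
  simp only [derivation, LinearMap.coe_mk, AddHom.coe_mk, map_mul, Matrix.mul_apply,
    Fin.sum_univ_two, derivationAux_entries]
  rw [add_comm]

theorem derivation_mul (n : ℕ × ZMod 2) (a b : FreeSuperComm deg) (ha : a ∈ homog deg n) :
    derivation D hD (a * b)
      = derivation D hD a * b + (-1 : ℝ) ^ n.1 • (a * derivation D hD b) := by
  rw [derivation_mul', invol_of_mem ha, smul_mul_assoc]

theorem derivation_one : derivation D hD 1 = 0 := by
  simp [derivation]

theorem derivation_mem (n : ℕ × ZMod 2) (a : FreeSuperComm deg) (ha : a ∈ homog deg n) :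
    derivation D hD a ∈ homog deg (n.1 + 1, n.2) := by
  induction ha using Submodule.span_induction with
  | zero => simp
  | add x y _ _ hx hy => rw [map_add]; exact add_mem hx hy
  | smul r x _ hx => rw [map_smul]; exact Submodule.smul_mem _ _ hx
  | mem x hx =>
    obtain ⟨l, rfl, rfl⟩ := hx
    induction l with
    | nil => simp [derivation_one]
    | cons y l ih =>
      simp only [List.map_cons, List.prod_cons, List.sum_cons]
      rw [derivation_mul D hD _ _ _ (gen_mem y), derivation_gen]
      refine add_mem ?_ (Submodule.smul_mem _ _ ?_)
      · convert mul_mem_homog (hD y) (word_mem l) using 2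
        ext <;> simp; ring
      · convert mul_mem_homog (gen_mem y) ih using 2
        ext <;> simp; ring

theorem derivation_sq (h : ∀ x, derivation D hD (D x) = 0) (a : FreeSuperComm deg) :
    derivation D hD (derivation D hD a) = 0 := by
  have ha : a ∈ Submodule.span ℝ (Set.range fun l : List X => (l.map (gen deg)).prod) := by
    rw [span_words]; trivial
  induction ha using Submodule.span_induction with
  | zero => simp
  | add x y _ _ hx hy => simp [hx, hy]
  | smul r x _ hx => simp [hx]
  | mem x hx =>
    obtain ⟨l, rfl⟩ := hx
    induction l with
    | nil => simp [derivation_one]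
    | cons y l ih =>
      simp only [List.map_cons, List.prod_cons] at ih ⊢
      rw [derivation_mul D hD _ _ _ (gen_mem y), derivation_gen, map_add, map_smul,
        derivation_mul D hD _ _ _ (hD y), derivation_mul D hD _ _ _ (gen_mem y), h, ih,
        derivation_gen]
      simp [pow_succ]

end derivation

/-- The coefficients of the part of word length one: the algebra homomorphism to the square-zero
extension `ℝ ⊕ ⟨generators⟩` followed by the projection. -/
def linPart (deg : X → ℕ × ZMod 2) : FreeSuperComm deg →ₗ[ℝ] (X →₀ ℝ) :=
  TrivSqZeroExt.sndHom ℝ (X →₀ ℝ) ∘ₗ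
    (lift (deg := deg) (B := TrivSqZeroExt ℝ (X →₀ ℝ))
      (fun x => TrivSqZeroExt.inr (Finsupp.single x 1)) fun x y => by
        rw [TrivSqZeroExt.inr_mul_inr, TrivSqZeroExt.inr_mul_inr]
        exact (smul_zero (A := TrivSqZeroExt ℝ (X →₀ ℝ)) (koszulSign (deg x) (deg y))).symm).toLinearMap

end FreeSuperComm

open FreeSuperComm

/-! ## Super `L_∞`-algebras -/

/-- A (connective) super `L_∞`-algebra of finite type, given by its Chevalley-Eilenberg algebra:
a differential of bidegree `(1, even)` on the free graded-commutative superalgebra on the dual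
basis elements, where a basis element of `𝔤` in degree `k ≥ 0` gives a generator in degree
`k + 1`. The word length `k` part of `d` is dual to the `k`-ary bracket. -/
structure SuperLInfinityAlgebra : Type 1 where
  Gen : Type
  deg : Gen → ℕ × ZMod 2
  one_le_deg : ∀ x, 1 ≤ (deg x).1
  finite_type : ∀ n : ℕ, {x | (deg x).1 = n}.Finite
  d : FreeSuperComm deg →ₗ[ℝ] FreeSuperComm deg
  d_mem : ∀ n a, a ∈ homog deg n → d a ∈ homog deg (n.1 + 1, n.2)
  d_mul : ∀ n a b, a ∈ homog deg n → d (a * b) = d a * b + (-1 : ℝ) ^ n.1 • (a * d b)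
  d_d : ∀ a, d (d a) = 0

namespace SuperLInfinityAlgebra

/-- The Chevalley-Eilenberg algebra. -/
abbrev CE (g : SuperLInfinityAlgebra) : Type := FreeSuperComm g.deg

/-- The super `L_∞`-algebra with `d x = D x` on generators. -/
def ofGen {X : Type} (deg : X → ℕ × ZMod 2) (one_le_deg : ∀ x, 1 ≤ (deg x).1)
    (finite_type : ∀ n : ℕ, {x | (deg x).1 = n}.Finite) (D : X → FreeSuperComm deg)
    (hD : ∀ x, D x ∈ homog deg ((deg x).1 + 1, (deg x).2))
    (hDD : ∀ x, derivation D hD (D x) = 0) : SuperLInfinityAlgebra where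
  Gen := X
  deg := deg
  one_le_deg := one_le_deg
  finite_type := finite_type
  d := derivation D hD
  d_mem := derivation_mem D hD
  d_mul := derivation_mul D hD
  d_d := derivation_sq D hD hDD

/-- A homomorphism `g → h` of super `L_∞`-algebras: a homomorphism of differential bigraded
algebras `CE(h) → CE(g)`. -/
@[ext] structure Hom (g h : SuperLInfinityAlgebra) where
  ce : h.CE →ₐ[ℝ] g.CE
  ce_mem : ∀ n a, a ∈ homog h.deg n → ce a ∈ homog g.deg n
  ce_d : ∀ a, ce (h.d a) = g.d (ce a)

instance : Category SuperLInfinityAlgebra where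
  Hom := Hom
  id g := ⟨AlgHom.id ℝ _, fun _ _ ha => ha, fun _ => rfl⟩
  comp f f' := ⟨f.ce.comp f'.ce, fun n a ha => f.ce_mem n _ (f'.ce_mem n a ha), fun a => by
    simp [f.ce_d, f'.ce_d]⟩

/-- The zero algebra, `CE(0) = ℝ`. -/
def zero : SuperLInfinityAlgebra :=
  ofGen (X := Empty) Empty.elim (fun x => x.elim) (fun _ => Set.toFinite _) Empty.elim
    (fun x => x.elim) (fun x => x.elim)

/-- `ℝ[n]`: the line in degree `n`; `CE(ℝ[n])` is free on one closed even generator in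
degree `n + 1`. -/
def line (n : ℕ) : SuperLInfinityAlgebra :=
  ofGen (X := Unit) (fun _ => (n + 1, 0)) (fun _ => by simp) (fun _ => Set.toFinite _) (fun _ => 0)
    (fun _ => zero_mem _) (fun _ => map_zero _)

theorem line_d_gen (n : ℕ) (x : (line n).Gen) : (line n).d (gen (line n).deg x) = 0 :=
  derivation_gen (deg := fun _ : Unit => (n + 1, 0)) (fun _ => 0) (fun _ => zero_mem _) x

/-- A `k`-cocycle: a closed (even) element of degree `k` in the Chevalley-Eilenberg algebra. -/
def IsCocycle (g : SuperLInfinityAlgebra) (k : ℕ) (μ : g.CE) : Prop :=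
  μ ∈ homog g.deg (k, 0) ∧ g.d μ = 0

/-- A derivation relation `f ∘ d = d ∘ f` may be checked on generators. -/
theorem comm_d_of_gen {g h : SuperLInfinityAlgebra} (f : h.CE →ₐ[ℝ] g.CE)
    (hmem : ∀ n a, a ∈ homog h.deg n → f a ∈ homog g.deg n)
    (hd : ∀ x, f (h.d (gen h.deg x)) = g.d (f (gen h.deg x))) (a : h.CE) :
    f (h.d a) = g.d (f a) := by
  have one : ∀ k : SuperLInfinityAlgebra, k.d 1 = 0 := fun k => by
    simpa using k.d_mul 0 1 1 one_mem_homog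
  have ha : a ∈ Submodule.span ℝ
      (Set.range fun l : List h.Gen => (l.map (gen h.deg)).prod) := by
    rw [span_words]; trivial
  induction ha using Submodule.span_induction with
  | zero => simp
  | add x y _ _ hx hy => simp [hx, hy]
  | smul r x _ hx => simp [hx]
  | mem x hx =>
    obtain ⟨l, rfl⟩ := hx
    induction l with
    | nil => simp [one]
    | cons y l ih =>
      simp only [List.map_cons, List.prod_cons] at ih ⊢
      rw [h.d_mul _ _ _ (gen_mem y), map_mul, g.d_mul _ _ _ (hmem _ _ (gen_mem y)), map_add,
        map_smul, map_mul, map_mul, hd, ih]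

/-- Extension of an assignment on generators to a homomorphism of super `L_∞`-algebras. -/
def homOfGen {g h : SuperLInfinityAlgebra} (f : h.Gen → g.CE)
    (hmem : ∀ x, f x ∈ homog g.deg (h.deg x))
    (hd : ∀ x, lift (deg := h.deg) f (fun x y => homog_mul_comm (hmem x) (hmem y))
      (h.d (gen h.deg x)) = g.d (f x)) : g ⟶ h :=
  have mem : ∀ n a, a ∈ homog h.deg n →
      lift (deg := h.deg) f (fun x y => homog_mul_comm (hmem x) (hmem y)) a ∈ homog g.deg n := by
    intro n a ha
    induction ha using Submodule.span_induction with
    | zero => simp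
    | add x y _ _ hx hy => rw [map_add]; exact add_mem hx hy
    | smul r x _ hx => rw [map_smul]; exact Submodule.smul_mem _ _ hx
    | mem x hx =>
      obtain ⟨l, rfl, rfl⟩ := hx
      induction l with
      | nil => simpa using one_mem_homog
      | cons y l ih =>
        simp only [List.map_cons, List.prod_cons, List.sum_cons, map_mul, lift_gen]
        exact mul_mem_homog (hmem y) ih
  ⟨lift (deg := h.deg) f (fun x y => homog_mul_comm (hmem x) (hmem y)), mem,
    comm_d_of_gen _ mem fun x => by rw [hd, lift_gen]⟩

/-- The homomorphism `μ : g → ℝ[n]` given by an `(n+1)`-cocycle: it pulls the generator of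
`CE(ℝ[n])` back to `μ`. -/
def cocycleHom {g : SuperLInfinityAlgebra} {n : ℕ} {μ : g.CE} (hμ : g.IsCocycle (n + 1) μ) :
    g ⟶ line n :=
  homOfGen (fun _ => μ) (fun _ => hμ.1) (fun x =>
    (congrArg _ (line_d_gen n x)).trans ((map_zero _).trans hμ.2.symm))

/-! ## Homotopy fibers -/

/-- The differential on `𝔤[1]^*`, the dual of the unary bracket. -/
def linDiff (g : SuperLInfinityAlgebra) : (g.Gen →₀ ℝ) →ₗ[ℝ] (g.Gen →₀ ℝ) :=
  Finsupp.linearCombination ℝ fun x => linPart g.deg (g.d (gen g.deg x))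

/-- The linear part of a homomorphism `f : g → h`, dually as a map `𝔥[1]^* → 𝔤[1]^*`. -/
def linMap {g h : SuperLInfinityAlgebra} (f : g ⟶ h) : (h.Gen →₀ ℝ) →ₗ[ℝ] (g.Gen →₀ ℝ) :=
  Finsupp.linearCombination ℝ fun x => linPart g.deg (f.ce (gen h.deg x))

/-- Weak equivalences of super `L_∞`-algebras: the linear part is a quasi-isomorphism of chain
complexes. As everything is degreewise finite-dimensional, this is the same as the dual map being
bijective on cohomology `ker / im`. -/
def IsWeakEquivalence {g h : SuperLInfinityAlgebra} (f : g ⟶ h) : Prop :=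
  (∀ v, h.linDiff v = 0 → linMap f v ∈ LinearMap.range g.linDiff →
      v ∈ LinearMap.range h.linDiff) ∧
    ∀ w, g.linDiff w = 0 → ∃ v, h.linDiff v = 0 ∧ w - linMap f v ∈ LinearMap.range g.linDiff

/-- Fibrations of connective super `L_∞`-algebras: the linear part is surjective in all positive
degrees, i.e. the dual map is injective on the span of the generators of degree at least two. -/
def IsFibration {g h : SuperLInfinityAlgebra} (f : g ⟶ h) : Prop :=
  ∀ v : h.Gen →₀ ℝ, (∀ x ∈ v.support, 2 ≤ (h.deg x).1) → linMap f v = 0 → v = 0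

/-- `p : F → g` is the homotopy fiber of `f : g → h`, i.e. the homotopy pullback of
`g → h ← 0`: for a factorization `0 → E → h` into a weak equivalence followed by a fibration,
`F` is weakly equivalent over `g` to the (strict) pullback `P` of `E → h` along `f`. -/
def IsHomotopyFiber {F g h : SuperLInfinityAlgebra} (p : F ⟶ g) (f : g ⟶ h) : Prop :=
  ∃ (E P : SuperLInfinityAlgebra) (i : zero ⟶ E) (q : E ⟶ h) (r : P ⟶ g) (s : P ⟶ E)
    (w : F ⟶ P),
    IsWeakEquivalence i ∧ IsFibration q ∧ IsPullback r s f q ∧ IsWeakEquivalence w ∧ w ≫ r = p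

end SuperLInfinityAlgebra

/-! ## Super-Minkowski algebras -/

/-- Real (Majorana) spinors with `N` components in `d`-dimensional Minkowski space: real matrices
`Γ^a` representing the Clifford algebra of the metric `diag(-1, 1, …, 1)`, and the charge
conjugation matrix `C` which defines the conjugate `ψ̄ = ψᵀ C`. The conditions on `C` say that
`C Γ^a C⁻¹ = -(Γ^a)ᵀ` and that `(ψ, φ) ↦ ψ̄ Γ^a φ` is symmetric; in a basis where `Γ^0` is
skew and the other `Γ^a` are symmetric, `C = Γ^0` gives the Dirac conjugate.
For `d = 11`, `N = 32` this is the irreducible Majorana representation `𝟑𝟐`; for `d = 10`,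
`N = 32` it is the Dirac representation `𝟏𝟔 ⊕ 𝟏𝟔'`, the two summands being the eigenspaces of the
product of all `Γ^a`. -/
structure MajoranaSpinors (d N : ℕ) where
  Γ : Fin d → Matrix (Fin N) (Fin N) ℝ
  C : Matrix (Fin N) (Fin N) ℝ
  clifford : ∀ a b, Γ a * Γ b + Γ b * Γ a =
    if a = b then (if a.val = 0 then (-2 : ℝ) else 2) • (1 : Matrix (Fin N) (Fin N) ℝ) else 0
  isUnit_C : IsUnit C
  C_transpose : C.transpose = -C
  CΓ_transpose : ∀ a, (C * Γ a).transpose = C * Γ a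

namespace MajoranaSpinors

open SuperLInfinityAlgebra

variable {d N : ℕ}

/-- Bidegrees of the generators: `e^a` (left) in `(1, even)`, `ψ^α` (right) in `(1, odd)`. -/
def genDeg (d N : ℕ) : Fin d ⊕ Fin N → ℕ × ZMod 2 :=
  Sum.elim (fun _ => (1, 0)) (fun _ => (1, 1))

/-- `ψ̄ ∧ M ψ = ∑ (C M)_{αβ} ψ^α ∧ ψ^β`. -/
def bilin (S : MajoranaSpinors d N) (M : Matrix (Fin N) (Fin N) ℝ) :
    FreeSuperComm (genDeg d N) :=
  ∑ α, ∑ β, (S.C * M) α β • (gen (genDeg d N) (Sum.inr α) * gen (genDeg d N) (Sum.inr β))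

theorem bilin_mem (S : MajoranaSpinors d N) (M : Matrix (Fin N) (Fin N) ℝ) :
    S.bilin M ∈ homog (genDeg d N) (2, 0) := by
  refine sum_mem fun α _ => sum_mem fun β _ => Submodule.smul_mem _ _ ?_
  have h := mul_mem_homog (gen_mem (deg := genDeg d N) (Sum.inr α))
    (gen_mem (deg := genDeg d N) (Sum.inr β))
  have e : genDeg d N (Sum.inr α) + genDeg d N (Sum.inr β) = (2, 0) := by
    simp only [genDeg, Sum.elim_inr, Prod.mk_add_mk]
    rfl
  rwa [e] at h

/-- The values of the differential on generators: `d e^a = ψ̄ ∧ Γ^a ψ`, `d ψ^α = 0`. -/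
def genDiff (S : MajoranaSpinors d N) : Fin d ⊕ Fin N → FreeSuperComm (genDeg d N) :=
  Sum.elim (fun a => S.bilin (S.Γ a)) (fun _ => 0)

theorem genDiff_mem (S : MajoranaSpinors d N) (x : Fin d ⊕ Fin N) :
    S.genDiff x ∈ homog (genDeg d N) ((genDeg d N x).1 + 1, (genDeg d N x).2) := by
  rcases x with a | α
  · exact S.bilin_mem _
  · exact zero_mem _

theorem derivation_bilin (S : MajoranaSpinors d N) (M : Matrix (Fin N) (Fin N) ℝ) :
    derivation S.genDiff S.genDiff_mem (S.bilin M) = 0 := by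
  have h : ∀ α, derivation S.genDiff S.genDiff_mem (gen (genDeg d N) (Sum.inr α)) = 0 :=
    fun α => by rw [derivation_gen]; rfl
  simp [bilin, derivation_mul', h]

/-- The super-translation algebra `ℝ^{d;N}` (super-Minkowski spacetime): generators `e^a`, `ψ^α`
with `d e^a = ψ̄ ∧ Γ^a ψ` and `d ψ^α = 0`. -/
def superMinkowski (S : MajoranaSpinors d N) : SuperLInfinityAlgebra :=
  ofGen (genDeg d N) (by rintro (a | α) <;> simp [genDeg]) (fun _ => Set.toFinite _)
    S.genDiff S.genDiff_mem (by
      rintro (a | α)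
      · exact S.derivation_bilin _
      · exact map_zero _)

/-- The chirality operator: the ordered product of all the `Γ^a`; for `d = 10` this is
`Γ^{11} = Γ^1 Γ^2 ⋯ Γ^{10}`. -/
def chirality (S : MajoranaSpinors d N) : Matrix (Fin N) (Fin N) ℝ :=
  (List.ofFn S.Γ).prod

/-- The D0-brane cocycle `ψ̄ ∧ Γ^{11} ψ` on `ℝ^{10;N=(1,1)}`. -/
def d0Cocycle (S : MajoranaSpinors 10 N) : S.superMinkowski.CE :=
  S.bilin S.chirality

end MajoranaSpinors

end

end SuperLInfinity

/-! The homotopy fiber of a cocycle `μ` of degree `n + 1` is modelled by the algebra with one extra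
generator `b` and `d b = μ`. The contractible algebra on `b, c` with `d b = c` fibers over the line,
and its pullback along `μ` is this extension: a cone is a homomorphism `f` to `g` together with a
`b` satisfying `d b = f^* μ` (`isPullback_extension`). It remains to compare the 11-dimensional
algebra with the extension of the 10-dimensional one by `ψ̄ ∧ Γ^{11} ψ`.

All differentials there are quadratic, so the linear complexes have zero differential, and a
homomorphism is a weak equivalence as soon as its linear part is bijective. The comparison is a
linear change of generators `ψ ↦ A ψ`, `e^a ↦ r e^a`, `b ↦ r c e^{11}`. It respects `d` if `A`
intertwines the first ten `Γ^a`, carries one charge conjugation matrix to `r` times the other, and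
carries the chirality operator to `c` times the last Clifford generator of dimension 11.

Since the two sets of data are arbitrary, `A`, `r`, `c` come from Clifford representation theory. As
`32 * 32 = 2 ^ 10`, the space of intertwiners of two representations is a line
(`finrank_intertwiners_univ`): each of the ten generators halves the space of all matrices. This
gives Schur's lemma and an invertible `A` (`exists_isUnit_intertwiner`). Schur's lemma, applied to a
quotient of two charge conjugation matrices and to `Γ^{11}` times the product of the other ten,
yields `r` and `c`. The scale `r` cannot be normalised away: `C` and `-C` are both admissible, while
rescaling `A` changes `r` only by a square. -/

namespace SuperLInfinity

open Module

/-! ### Intertwiners of Clifford representations, by averaging and dimension count. -/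

section Clifford

variable {ι m : Type*} [Fintype m]

/-- Matrices representing the Clifford algebra of a diagonal nondegenerate quadratic form `ε`. -/
structure IsCliffordFamily [DecidableEq m] (ε : ι → ℝ) (Γ : ι → Matrix m m ℝ) : Prop where
  ne_zero : ∀ a, ε a ≠ 0
  sq : ∀ a, Γ a * Γ a = ε a • (1 : Matrix m m ℝ)
  anti : ∀ a b, a ≠ b → Γ a * Γ b = -(Γ b * Γ a)

/-- The matrices intertwining `Γ' a` and `Γ a` for all `a` in `s`. -/
def intertwiners (Γ Γ' : ι → Matrix m m ℝ) (s : Finset ι) : Submodule ℝ (Matrix m m ℝ) where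
  carrier := {X | ∀ a ∈ s, Γ a * X = X * Γ' a}
  zero_mem' := fun a _ => by simp
  add_mem' := fun hX hY a ha => by rw [mul_add, add_mul, hX a ha, hY a ha]
  smul_mem' := fun c X hX a ha => by rw [mul_smul_comm, smul_mul_assoc, hX a ha]

variable {ε : ι → ℝ} {Γ Γ' : ι → Matrix m m ℝ}

/-- Averaging over the group generated by one more Clifford generator. -/
noncomputable def average (ε : ι → ℝ) (Γ Γ' : ι → Matrix m m ℝ) (b : ι) (X : Matrix m m ℝ) :
    Matrix m m ℝ :=
  X + (ε b)⁻¹ • (Γ b * X * Γ' b)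

/-- Moving `a` past `b` costs a sign on each side of `X`, and the two signs cancel. Hence averaging
over `b` does not spoil the relations already achieved. -/
theorem mul_conj_of_anticomm {a b : ι} {X : Matrix m m ℝ} (h : Γ a * Γ b = -(Γ b * Γ a))
    (h' : Γ' a * Γ' b = -(Γ' b * Γ' a)) (hX : Γ a * X = X * Γ' a) :
    Γ a * (Γ b * X * Γ' b) = Γ b * X * Γ' b * Γ' a := by
  calc Γ a * (Γ b * X * Γ' b) = Γ a * Γ b * X * Γ' b := by simp only [mul_assoc]
    _ = -(Γ b * (Γ a * X) * Γ' b) := by rw [h]; simp only [mul_assoc, neg_mul]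
    _ = -(Γ b * X * (Γ' a * Γ' b)) := by rw [hX]; simp only [mul_assoc]
    _ = Γ b * X * Γ' b * Γ' a := by rw [h']; simp only [mul_assoc, mul_neg, neg_neg]

variable [DecidableEq m]

namespace IsCliffordFamily

theorem isUnit (h : IsCliffordFamily ε Γ) (a : ι) : IsUnit (Γ a) := by
  refine IsUnit.of_mul_eq_one ((ε a)⁻¹ • Γ a) ?_
  rw [mul_smul_comm, h.sq, smul_smul, inv_mul_cancel₀ (h.ne_zero a), one_smul]

/-- As `(ε b)⁻¹ • Γ' b` is the inverse of `Γ' b`, the average is `X` plus its conjugate `Γ b * X *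
(Γ' b)⁻¹`. This conjugation is an involution because both families have the same `ε`. -/
theorem average_comm (h : IsCliffordFamily ε Γ) (h' : IsCliffordFamily ε Γ') (b : ι)
    (X : Matrix m m ℝ) : Γ b * average ε Γ Γ' b X = average ε Γ Γ' b X * Γ' b := by
  have h1 : Γ b * (Γ b * X * Γ' b) = ε b • (X * Γ' b) := by
    rw [mul_assoc, ← mul_assoc, h.sq, smul_mul_assoc, one_mul]
  have h2 : Γ b * X * Γ' b * Γ' b = ε b • (Γ b * X) := by
    rw [mul_assoc (Γ b * X), h'.sq, mul_smul_comm, mul_one]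
  rw [average, mul_add, add_mul, mul_smul_comm, smul_mul_assoc, h1, h2, smul_smul, smul_smul,
    inv_mul_cancel₀ (h.ne_zero b), one_smul, one_smul, add_comm]

theorem average_mem [DecidableEq ι] (h : IsCliffordFamily ε Γ) (h' : IsCliffordFamily ε Γ') {s : Finset ι} (b : ι)
    {X : Matrix m m ℝ} (hX : X ∈ intertwiners Γ Γ' s) :
    average ε Γ Γ' b X ∈ intertwiners Γ Γ' (insert b s) := by
  intro a ha
  rcases eq_or_ne a b with rfl | hab
  · exact average_comm h h' a X
  · have hs : a ∈ s := (Finset.mem_insert.1 ha).resolve_left hab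
    rw [average, mul_add, add_mul, mul_smul_comm, smul_mul_assoc, hX a hs,
      mul_conj_of_anticomm (h.anti a b hab) (h'.anti a b hab) (hX a hs)]

/-- Each Clifford generator halves the space of intertwiners. -/
theorem finrank_intertwiners_insert [DecidableEq ι] (h : IsCliffordFamily ε Γ)
    (h' : IsCliffordFamily ε Γ')
    {ω : Matrix m m ℝ} (hω : IsUnit ω) (hωΓ : ∀ a, ω * Γ a = -(Γ a * ω)) {s : Finset ι} {b : ι}
    (hb : b ∉ s) :
    finrank ℝ (intertwiners Γ Γ' s) = 2 * finrank ℝ (intertwiners Γ Γ' (insert b s)) := by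
  set W := intertwiners Γ Γ' (insert b s) with hW
  -- `W` and `K` are the eigenspaces for `+1` and `-1` of the involution `X ↦ Γ b * X * (Γ' b)⁻¹` on
  -- the intertwiners for `s`; half the average is the projection onto `W`.
  let K : Submodule ℝ (Matrix m m ℝ) :=
    { carrier := {X | X ∈ intertwiners Γ Γ' s ∧ Γ b * X = -(X * Γ' b)}
      zero_mem' := ⟨zero_mem _, by simp⟩
      add_mem' := fun hX hY => ⟨add_mem hX.1 hY.1, by rw [mul_add, add_mul, hX.2, hY.2, neg_add]⟩
      smul_mem' := fun c X hX => ⟨Submodule.smul_mem _ _ hX.1, by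
        rw [mul_smul_comm, smul_mul_assoc, hX.2, smul_neg]⟩ }
  have hWs : W ≤ intertwiners Γ Γ' s := fun X hX a ha => hX a (Finset.mem_insert_of_mem ha)
  have hWb : ∀ X ∈ W, Γ b * X = X * Γ' b := fun X hX => hX b (Finset.mem_insert_self b s)
  have hmem : ∀ X ∈ intertwiners Γ Γ' s, Γ b * X = X * Γ' b → X ∈ W := by
    intro X hX hXb a ha
    rcases Finset.mem_insert.1 ha with rfl | ha
    exacts [hXb, hX a ha]
  have hinf : W ⊓ K = ⊥ := by
    rw [eq_bot_iff]
    rintro X ⟨hXW, hXK⟩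
    have h0 : Γ b * X = 0 := by
      have h1 := hXK.2
      rw [← hWb X hXW] at h1
      rw [eq_neg_iff_add_eq_zero, ← two_smul ℝ, smul_eq_zero] at h1
      exact h1.resolve_left two_ne_zero
    exact ((h.isUnit b).mul_right_eq_zero).1 h0
  have hsup : W ⊔ K = intertwiners Γ Γ' s := by
    refine le_antisymm (sup_le hWs fun X hX => hX.1) fun X hX => ?_
    have hav := average_mem h h' b hX
    refine Submodule.mem_sup.2 ⟨(1 / 2 : ℝ) • average ε Γ Γ' b X, Submodule.smul_mem _ _ hav,
      X - (1 / 2 : ℝ) • average ε Γ Γ' b X, ⟨sub_mem hX (Submodule.smul_mem _ _ (hWs hav)), ?_⟩,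
      by abel⟩
    have h1 : Γ b * (Γ b * X * Γ' b) = ε b • (X * Γ' b) := by
      rw [mul_assoc, ← mul_assoc, h.sq, smul_mul_assoc, one_mul]
    have h2 : Γ b * X * Γ' b * Γ' b = ε b • (Γ b * X) := by
      rw [mul_assoc (Γ b * X), h'.sq, mul_smul_comm, mul_one]
    rw [average, mul_sub, sub_mul, mul_smul_comm, smul_mul_assoc, mul_add, add_mul,
      mul_smul_comm, smul_mul_assoc, h1, h2, smul_smul, smul_smul, inv_mul_cancel₀ (h.ne_zero b)]
    module
  -- `ω * Γ b` commutes with `Γ a` for `a ∈ s` (two signs, using `b ∉ s`) and anticommutes with `Γ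
  -- b`. Left multiplication by it therefore embeds `W` in `K` and `K` in `W`, so the two have equal
  -- dimension.
  have hU : IsUnit (ω * Γ b) := hω.mul (h.isUnit b)
  have hinj : Function.Injective (LinearMap.mulLeft ℝ (ω * Γ b)) := fun X Y hXY =>
    hU.mul_left_cancel hXY
  have hUs : ∀ X ∈ intertwiners Γ Γ' s, ω * Γ b * X ∈ intertwiners Γ Γ' s := by
    intro X hX a ha
    have hab : b ≠ a := fun e => hb (e ▸ ha)
    have : Γ a * (ω * Γ b) = ω * Γ b * Γ a := by
      rw [mul_assoc ω, h.anti b a hab, mul_neg, ← mul_assoc, ← mul_assoc, hωΓ a, neg_mul, neg_neg]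
    rw [← mul_assoc, this, mul_assoc _ (Γ a), hX a ha, mul_assoc _ X]
  have hUb : ∀ X : Matrix m m ℝ, Γ b * (ω * Γ b * X) = -(ω * Γ b * (Γ b * X)) := by
    intro X
    have : Γ b * (ω * Γ b) = -(ω * Γ b * Γ b) := by
      rw [← mul_assoc, eq_neg_iff_add_eq_zero, ← add_mul, hωΓ b, add_neg_cancel, zero_mul]
    rw [← mul_assoc, this, neg_mul, mul_assoc _ (Γ b) X]
  have hWK : finrank ℝ W ≤ finrank ℝ K := by
    rw [(Submodule.equivMapOfInjective _ hinj W).finrank_eq]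
    refine Submodule.finrank_mono ?_
    rintro _ ⟨X, hX, rfl⟩
    refine ⟨hUs X (hWs hX), ?_⟩
    rw [LinearMap.mulLeft_apply, hUb, hWb X hX, mul_assoc _ X]
  have hKW : finrank ℝ K ≤ finrank ℝ W := by
    rw [(Submodule.equivMapOfInjective _ hinj K).finrank_eq]
    refine Submodule.finrank_mono ?_
    rintro _ ⟨X, hX, rfl⟩
    refine hmem _ (hUs X hX.1) ?_
    rw [LinearMap.mulLeft_apply, hUb, hX.2, mul_neg, neg_neg, mul_assoc _ X]
  have := Submodule.finrank_sup_add_finrank_inf_eq W K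
  rw [hinf, hsup, finrank_bot] at this
  omega

/-- In the dimension of the irreducible representation of an even Clifford algebra, the
intertwiners of two representations form a line. -/
theorem finrank_intertwiners_univ [Fintype ι] (h : IsCliffordFamily ε Γ)
    (h' : IsCliffordFamily ε Γ')
    {ω : Matrix m m ℝ} (hω : IsUnit ω) (hωΓ : ∀ a, ω * Γ a = -(Γ a * ω))
    (hcard : Fintype.card m * Fintype.card m = 2 ^ Fintype.card ι) :
    finrank ℝ (intertwiners Γ Γ' Finset.univ) = 1 := by
  classical
  have key : ∀ s : Finset ι,
      2 ^ s.card * finrank ℝ (intertwiners Γ Γ' s) = Fintype.card m * Fintype.card m := by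
    intro s
    induction s using Finset.induction_on with
    | empty =>
      have : intertwiners Γ Γ' ∅ = ⊤ := by
        rw [eq_top_iff]
        intro X _ a ha
        simp at ha
      rw [this, finrank_top, finrank_matrix]
      simp
    | insert b s hb ih =>
      rw [← ih, finrank_intertwiners_insert h h' hω hωΓ hb, Finset.card_insert_of_notMem hb]
      ring
  have := key Finset.univ
  rw [hcard, Finset.card_univ] at this
  exact Nat.eq_of_mul_eq_mul_left (by positivity) (this.trans (mul_one _).symm)

/-- Schur's lemma. -/
theorem exists_eq_smul_one [Fintype ι] [Nonempty m] (h : IsCliffordFamily ε Γ)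
    {ω : Matrix m m ℝ} (hω : IsUnit ω) (hωΓ : ∀ a, ω * Γ a = -(Γ a * ω))
    (hcard : Fintype.card m * Fintype.card m = 2 ^ Fintype.card ι) {Y : Matrix m m ℝ}
    (hY : ∀ a, Γ a * Y = Y * Γ a) : ∃ c : ℝ, Y = c • (1 : Matrix m m ℝ) := by
  have h1 := finrank_intertwiners_univ h h hω hωΓ hcard
  have hone : (1 : Matrix m m ℝ) ∈ intertwiners Γ Γ Finset.univ := fun a _ => by simp
  obtain ⟨c, hc⟩ := (finrank_eq_one_iff_of_nonzero' (⟨1, hone⟩ : intertwiners Γ Γ Finset.univ)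
    (fun e => one_ne_zero (congrArg Subtype.val e))).1 h1 ⟨Y, fun a _ => hY a⟩
  exact ⟨c, (congrArg Subtype.val hc).symm⟩

/-- Two irreducible representations of an even Clifford algebra are equivalent. -/
theorem exists_isUnit_intertwiner [Fintype ι] [Nonempty m] (h : IsCliffordFamily ε Γ)
    (h' : IsCliffordFamily ε Γ')
    {ω : Matrix m m ℝ} (hω : IsUnit ω) (hωΓ : ∀ a, ω * Γ a = -(Γ a * ω))
    (hcard : Fintype.card m * Fintype.card m = 2 ^ Fintype.card ι) :
    ∃ A : Matrix m m ℝ, IsUnit A ∧ ∀ a, Γ a * A = A * Γ' a := by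
  classical
  have h1 := finrank_intertwiners_univ h h' hω hωΓ hcard
  obtain ⟨⟨A, hA⟩, hA0, -⟩ := finrank_eq_one_iff'.1 h1
  have hA0 : A ≠ 0 := fun e => hA0 (Subtype.ext e)
  refine ⟨A, ?_, fun a => hA a (Finset.mem_univ a)⟩
  -- A nonzero intertwiner in the opposite direction is obtained by averaging the transpose of `A`.
  -- The trace pairing with `A` starts positive, as `A ≠ 0`, and each averaging doubles it.
  have key : ∀ s : Finset ι, ∃ Z ∈ intertwiners Γ' Γ s, (A * Z).trace ≠ 0 := by
    intro s
    induction s using Finset.induction_on with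
    | empty =>
      refine ⟨A.conjTranspose, fun a ha => by simp at ha, fun e => hA0 ?_⟩
      exact Matrix.trace_mul_conjTranspose_self_eq_zero_iff.1 e
    | insert b s hb ih =>
      obtain ⟨Z, hZ, hZ0⟩ := ih
      refine ⟨average ε Γ' Γ b Z, average_mem h' h b hZ, ?_⟩
      have e : (A * (Γ' b * Z * Γ b)).trace = ε b * (A * Z).trace := by
        rw [← mul_assoc, ← mul_assoc, ← hA b (Finset.mem_univ b), Matrix.trace_mul_comm,
          ← mul_assoc, ← mul_assoc, h.sq, mul_assoc, smul_mul_assoc, one_mul, Matrix.trace_smul,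
          smul_eq_mul]
      rw [average, mul_add, mul_smul_comm, Matrix.trace_add, Matrix.trace_smul, e, smul_eq_mul,
        ← mul_assoc, inv_mul_cancel₀ (h.ne_zero b), one_mul]
      intro e0
      exact hZ0 (by linarith)
  obtain ⟨Z, hZ, hZ0⟩ := key Finset.univ
  -- `A * Z` commutes with every `Γ a`, hence is scalar; its nonzero trace makes the scalar
  -- invertible.
  obtain ⟨c, hc⟩ := h.exists_eq_smul_one hω hωΓ hcard (Y := A * Z) fun a => by
    rw [← mul_assoc, hA a (Finset.mem_univ a), mul_assoc, hZ a (Finset.mem_univ a), mul_assoc]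
  have hc0 : c ≠ 0 := by
    rintro rfl
    simp [hc] at hZ0
  refine IsUnit.of_mul_eq_one (c⁻¹ • Z) ?_
  rw [mul_smul_comm, hc, smul_smul, inv_mul_cancel₀ hc0, one_smul]

end IsCliffordFamily

end Clifford

/-! ### Signs in products of anticommuting elements. -/

section Chirality

variable {R : Type*} [Ring R]

theorem prod_mul_of_anticomm {l : List R} {x : R} (h : ∀ y ∈ l, y * x = -(x * y)) :
    l.prod * x = (-1) ^ l.length * (x * l.prod) := by
  induction l with
  | nil => simp
  | cons y l ih =>
    rw [List.prod_cons, mul_assoc, ih fun z hz => h z (List.mem_cons_of_mem y hz),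
      ← mul_assoc, ← (Commute.neg_one_left y).pow_left _ |>.eq, mul_assoc, ← mul_assoc y,
      h y List.mem_cons_self, List.length_cons, pow_succ]
    simp [mul_assoc]

/-- `Γ a` commutes with its own factor and anticommutes with the other `n - 1`. The minus sign on
the left replaces the exponent `n - 1` by `n`. -/
theorem prod_ofFn_mul_of_anticomm {n : ℕ} {Γ : Fin n → R}
    (h : ∀ a b, a ≠ b → Γ a * Γ b = -(Γ b * Γ a)) (a : Fin n) :
    -((List.ofFn Γ).prod * Γ a) = (-1) ^ n * (Γ a * (List.ofFn Γ).prod) := by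
  induction n with
  | zero => exact a.elim0
  | succ n ih =>
    rw [List.ofFn_succ, List.prod_cons]
    refine Fin.cases ?_ (fun i => ?_) a
    · have := prod_mul_of_anticomm (l := List.ofFn fun i : Fin n => Γ i.succ) (x := Γ 0) (by
        intro y hy
        obtain ⟨i, rfl⟩ := (List.mem_ofFn' _ _).1 hy
        exact h _ _ (Fin.succ_ne_zero i))
      rw [mul_assoc, this, List.length_ofFn, ← mul_assoc (Γ 0) (_ ^ _),
        ← (Commute.neg_one_left (Γ 0)).pow_left _ |>.eq, pow_succ]
      simp [mul_assoc]
    · have := ih (Γ := fun i : Fin n => Γ i.succ) (fun a b hab => h _ _ (by simpa using hab)) i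
      rw [mul_assoc, ← mul_neg, this, ← mul_assoc (Γ 0) (_ ^ _),
        ← (Commute.neg_one_left (Γ 0)).pow_left _ |>.eq, ← mul_assoc (Γ i.succ),
        h _ _ (Fin.succ_ne_zero i), pow_succ]
      simp [mul_assoc]

theorem list_prod_mul_of_intertwine {ι : Type*} {Γ Γ' : ι → R} {A : R}
    (h : ∀ a, Γ a * A = A * Γ' a) (l : List ι) :
    (l.map Γ).prod * A = A * (l.map Γ').prod := by
  induction l with
  | nil => simp
  | cons a l ih => rw [List.map_cons, List.map_cons, List.prod_cons, List.prod_cons, mul_assoc, ih,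
      ← mul_assoc, h, mul_assoc]

end Chirality

/-! ### Uniqueness of Majorana spinors in the irreducible dimension. -/

namespace MajoranaSpinors

variable {d N : ℕ}

theorem isCliffordFamily (S : MajoranaSpinors d N) :
    IsCliffordFamily (fun a : Fin d => if a.val = 0 then (-1 : ℝ) else 1) S.Γ where
  ne_zero a := by split_ifs <;> norm_num
  sq a := by
    have := S.clifford a a
    rw [if_pos rfl, ← two_smul ℝ] at this
    have h2 := congrArg (fun M => (1 / 2 : ℝ) • M) this
    simp only [smul_smul] at h2
    norm_num at h2
    rw [h2]
    split_ifs <;> norm_num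
  anti a b hab := by
    have := S.clifford a b
    rw [if_neg hab] at this
    exact eq_neg_of_add_eq_zero_left this

theorem isUnit_chirality (S : MajoranaSpinors d N) : IsUnit S.chirality := by
  refine List.prod_induction IsUnit (fun a b => IsUnit.mul) isUnit_one fun x hx => ?_
  obtain ⟨a, rfl⟩ := (List.mem_ofFn' _ _).1 hx
  exact S.isCliffordFamily.isUnit a

/-- Among an even number of factors, an odd number anticommute with `Γ a`. The chirality operator
thus serves as the `ω` of the intertwiner count. -/
theorem chirality_anticomm (S : MajoranaSpinors d N) (hd : Even d) (a : Fin d) :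
    S.chirality * S.Γ a = -(S.Γ a * S.chirality) := by
  have := prod_ofFn_mul_of_anticomm S.isCliffordFamily.anti a
  rw [hd.neg_one_pow, one_mul] at this
  rw [chirality, ← this, neg_neg]

/-- Dimensional reduction: forget the last Clifford generator. -/
def reduce (S : MajoranaSpinors (d + 1) N) : MajoranaSpinors d N where
  Γ a := S.Γ a.castSucc
  C := S.C
  clifford a b := by
    simpa using S.clifford a.castSucc b.castSucc
  isUnit_C := S.isUnit_C
  C_transpose := S.C_transpose
  CΓ_transpose a := S.CΓ_transpose a.castSucc

/-- Symmetry of `C * Γ a` and antisymmetry of `C` combine: `C` intertwines `Γ a` with `-(Γ a)ᵀ`. -/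
theorem C_mul_Γ (S : MajoranaSpinors d N) (a : Fin d) :
    S.C * S.Γ a = -((S.Γ a).transpose * S.C) := by
  rw [← S.CΓ_transpose a, Matrix.transpose_mul, S.C_transpose, mul_neg]

/-- In the irreducible dimension, Majorana representations in even dimension are equivalent,
compatibly with the charge conjugation matrices up to a scale. -/
theorem exists_equivalence [NeZero N] (S T : MajoranaSpinors d N) (hd : Even d)
    (hN : N * N = 2 ^ d) :
    ∃ (A : Matrix (Fin N) (Fin N) ℝ) (r : ℝ), IsUnit A ∧ r ≠ 0 ∧ (∀ a, S.Γ a * A = A * T.Γ a) ∧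
      A.transpose * S.C * A = r • T.C := by
  have hcard : Fintype.card (Fin N) * Fintype.card (Fin N) = 2 ^ Fintype.card (Fin d) := by
    simpa using hN
  obtain ⟨A, hA, hAΓ⟩ := S.isCliffordFamily.exists_isUnit_intertwiner T.isCliffordFamily
    S.isUnit_chirality (S.chirality_anticomm hd) hcard
  obtain ⟨⟨U, V, hUV, hVU⟩, rfl : U = T.C⟩ := T.isUnit_C
  -- Both `T.C` and `Aᵀ * S.C * A` intertwine `T.Γ a` with `-(T.Γ a)ᵀ`, so their quotient, formed
  -- with `V = T.C⁻¹`, commutes with all `T.Γ a` and is a scalar `r`.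
  obtain ⟨r, hr⟩ := T.isCliffordFamily.exists_eq_smul_one T.isUnit_chirality
    (T.chirality_anticomm hd) hcard (Y := V * (A.transpose * S.C * A)) fun a => by
      have h1 : T.Γ a * V = -(V * (T.Γ a).transpose) := by
        calc T.Γ a * V = V * (T.C * T.Γ a) * V := by rw [← mul_assoc, hVU, one_mul]
          _ = -(V * (T.Γ a).transpose * (T.C * V)) := by
            rw [T.C_mul_Γ]; simp only [mul_assoc, neg_mul, mul_neg]
          _ = _ := by rw [hUV, mul_one]
      have h2 : (T.Γ a).transpose * A.transpose = A.transpose * (S.Γ a).transpose := by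
        rw [← Matrix.transpose_mul, ← hAΓ, Matrix.transpose_mul]
      calc T.Γ a * (V * (A.transpose * S.C * A))
          = -(V * (((T.Γ a).transpose * A.transpose) * S.C * A)) := by
            rw [← mul_assoc, h1]; simp only [mul_assoc, neg_mul]
        _ = V * (A.transpose * -((S.Γ a).transpose * S.C) * A) := by
            rw [h2]; simp only [mul_assoc, neg_mul, mul_neg]
        _ = V * (A.transpose * S.C * (S.Γ a * A)) := by
            rw [← S.C_mul_Γ]; simp only [mul_assoc]
        _ = _ := by rw [hAΓ]; simp only [mul_assoc]
  have hr' : A.transpose * S.C * A = r • T.C := by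
    have := congrArg (T.C * ·) hr
    simpa only [← mul_assoc, hUV, one_mul, mul_smul_comm, mul_one] using this
  refine ⟨A, r, hA, ?_, hAΓ, hr'⟩
  rintro rfl
  rw [zero_smul] at hr'
  exact (((Matrix.isUnit_transpose A).2 hA).mul S.isUnit_C |>.mul hA).ne_zero hr'

/-- The last Clifford generator in odd dimension is a multiple of the product of the others. -/
theorem exists_chirality_reduce [NeZero N] (T : MajoranaSpinors (d + 1) N) (hd : Even d)
    (hN : N * N = 2 ^ d) :
    ∃ c : ℝ, c ≠ 0 ∧ T.reduce.chirality = c • T.Γ (Fin.last d) := by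
  have hcard : Fintype.card (Fin N) * Fintype.card (Fin N) = 2 ^ Fintype.card (Fin d) := by
    simpa using hN
  -- The last generator and the product of the others each anticommute with the first `d`
  -- generators; their product commutes with them, so it is scalar.
  obtain ⟨c, hc⟩ := T.reduce.isCliffordFamily.exists_eq_smul_one T.reduce.isUnit_chirality
    (T.reduce.chirality_anticomm hd) hcard (Y := T.Γ (Fin.last d) * T.reduce.chirality)
    fun a => by
      have h1 : T.reduce.Γ a * T.Γ (Fin.last d) = -(T.Γ (Fin.last d) * T.reduce.Γ a) :=
        T.isCliffordFamily.anti _ _ (Fin.castSucc_lt_last a).ne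
      rw [← mul_assoc, h1, mul_assoc, T.reduce.chirality_anticomm hd, mul_neg, neg_mul, mul_assoc]
  have hsq := T.isCliffordFamily.sq (Fin.last d)
  have hε := T.isCliffordFamily.ne_zero (Fin.last d)
  set e : ℝ := if (Fin.last d).val = 0 then -1 else 1
  have hχ : T.reduce.chirality = (e⁻¹ * c) • T.Γ (Fin.last d) := by
    have := congrArg (e⁻¹ • T.Γ (Fin.last d) * ·) hc
    simp only [smul_mul_assoc, ← mul_assoc, hsq, one_mul, mul_smul_comm, mul_one] at this
    rw [inv_smul_smul₀ hε, smul_smul, mul_comm] at this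
    rw [this, mul_comm]
  refine ⟨_, ?_, hχ⟩
  intro h0
  rw [h0, zero_smul] at hχ
  exact T.reduce.isUnit_chirality.ne_zero hχ

end MajoranaSpinors

end SuperLInfinity

/-! ### Extensions of super `L_∞`-algebras by a cocycle, and their universal property. -/

namespace SuperLInfinity
noncomputable section
open FreeSuperComm

namespace FreeSuperComm

variable {X : Type} {deg : X → ℕ × ZMod 2}

theorem algHom_ext {B : Type} [Ring B] [Algebra ℝ B] {f g : FreeSuperComm deg →ₐ[ℝ] B}
    (h : ∀ x, f (gen deg x) = g (gen deg x)) : f = g := by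
  ext a
  have ha : a ∈ Submodule.span ℝ (Set.range fun l : List X => (l.map (gen deg)).prod) := by
    rw [span_words]; trivial
  induction ha using Submodule.span_induction with
  | zero => simp
  | add x y _ _ hx hy => simp [hx, hy]
  | smul r x _ hx => simp [hx]
  | mem x hx =>
    obtain ⟨l, rfl⟩ := hx
    induction l with
    | nil => simp
    | cons y l ih => simp only [List.map_cons, List.prod_cons, map_mul, h] at ih ⊢; rw [ih]

@[simp] theorem linPart_gen (x : X) : linPart deg (gen deg x) = Finsupp.single x 1 := by
  simp [linPart]

@[simp] theorem linPart_gen_mul_gen (x y : X) : linPart deg (gen deg x * gen deg y) = 0 := by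
  simp [linPart]

end FreeSuperComm

namespace SuperLInfinityAlgebra

theorem hom_ext {g h : SuperLInfinityAlgebra} {f f' : g ⟶ h}
    (w : ∀ x, f.ce (gen h.deg x) = f'.ce (gen h.deg x)) : f = f' :=
  Hom.ext (algHom_ext w)

theorem comp_ce {g h k : SuperLInfinityAlgebra} (f : g ⟶ h) (f' : h ⟶ k) (a : k.CE) :
    (f ≫ f').ce a = f.ce (f'.ce a) := rfl

theorem homOfGen_ce_gen {g h : SuperLInfinityAlgebra} (f : h.Gen → g.CE)
    (hmem : ∀ x, f x ∈ homog g.deg (h.deg x)) (hd) (x : h.Gen) :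
    (homOfGen f hmem hd).ce (gen h.deg x) = f x :=
  lift_gen f (fun x y => homog_mul_comm (hmem x) (hmem y)) x

theorem cocycleHom_ce_gen {g : SuperLInfinityAlgebra} {n : ℕ} {μ : g.CE}
    (hμ : g.IsCocycle (n + 1) μ) (x : (line n).Gen) :
    (cocycleHom hμ).ce (gen (line n).deg x) = μ :=
  homOfGen_ce_gen _ _ _ x

/-- Bidegrees of the generators of an extension by one even generator in degree `n`. -/
def extensionDeg (g : SuperLInfinityAlgebra) (n : ℕ) : g.Gen ⊕ Unit → ℕ × ZMod 2 :=
  Sum.elim g.deg fun _ => (n, 0)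

/-- The inclusion of `CE(g)` into the extension. -/
def extensionIncl (g : SuperLInfinityAlgebra) (n : ℕ) :
    g.CE →ₐ[ℝ] FreeSuperComm (g.extensionDeg n) :=
  lift (fun x => gen (g.extensionDeg n) (Sum.inl x)) fun x y =>
    gen_mul_gen (deg := g.extensionDeg n) (Sum.inl x) (Sum.inl y)

theorem extensionIncl_gen (g : SuperLInfinityAlgebra) (n : ℕ) (x : g.Gen) :
    g.extensionIncl n (gen g.deg x) = gen (g.extensionDeg n) (Sum.inl x) :=
  lift_gen _ _ _

theorem extensionIncl_mem (g : SuperLInfinityAlgebra) (n : ℕ) {k : ℕ × ZMod 2} {a : g.CE}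
    (ha : a ∈ homog g.deg k) : g.extensionIncl n a ∈ homog (g.extensionDeg n) k := by
  induction ha using Submodule.span_induction with
  | zero => simp
  | add x y _ _ hx hy => rw [map_add]; exact add_mem hx hy
  | smul r x _ hx => rw [map_smul]; exact Submodule.smul_mem _ _ hx
  | mem x hx =>
    obtain ⟨l, rfl, rfl⟩ := hx
    induction l with
    | nil => simpa using one_mem_homog
    | cons y l ih =>
      simp only [List.map_cons, List.prod_cons, List.sum_cons, map_mul, extensionIncl_gen]
      exact mul_mem_homog (gen_mem (deg := g.extensionDeg n) (Sum.inl y)) ih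

section extension

variable (g : SuperLInfinityAlgebra) {n : ℕ} {μ : g.CE}

/-- The differential of the extension: the new generator is sent to `μ`. -/
def extensionDiff (n : ℕ) (μ : g.CE) : g.Gen ⊕ Unit → FreeSuperComm (g.extensionDeg n) :=
  Sum.elim (fun x => g.extensionIncl n (g.d (gen g.deg x))) fun _ => g.extensionIncl n μ

theorem extensionDiff_mem (hμ : g.IsCocycle (n + 1) μ) (x : g.Gen ⊕ Unit) :
    g.extensionDiff n μ x ∈
      homog (g.extensionDeg n) ((g.extensionDeg n x).1 + 1, (g.extensionDeg n x).2) := by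
  rcases x with x | x
  · exact g.extensionIncl_mem n (g.d_mem _ _ (gen_mem x))
  · exact g.extensionIncl_mem n hμ.1

/-- Both sides are derivations along the inclusion and agree on generators. It gives `d ∘ d = 0` on
the extension and makes the projection a homomorphism. -/
theorem derivation_extensionIncl (hμ : g.IsCocycle (n + 1) μ) (a : g.CE) :
    derivation (g.extensionDiff n μ) (g.extensionDiff_mem hμ) (g.extensionIncl n a)
      = g.extensionIncl n (g.d a) := by
  have one : g.d 1 = 0 := by simpa using g.d_mul 0 1 1 one_mem_homog
  have ha : a ∈ Submodule.span ℝ (Set.range fun l : List g.Gen => (l.map (gen g.deg)).prod) := by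
    rw [span_words]; trivial
  induction ha using Submodule.span_induction with
  | zero => simp
  | add x y _ _ hx hy => simp [hx, hy]
  | smul r x _ hx => simp [hx]
  | mem x hx =>
    obtain ⟨l, rfl⟩ := hx
    induction l with
    | nil => simp [one, derivation_one]
    | cons y l ih =>
      simp only [List.map_cons, List.prod_cons] at ih ⊢
      rw [map_mul, derivation_mul _ _ _ _ _ (g.extensionIncl_mem n (gen_mem y)), ih,
        g.d_mul _ _ _ (gen_mem y), map_add, map_smul, map_mul, map_mul, extensionIncl_gen,
        derivation_gen]
      rfl

/-- The extension of `g` classified by a cocycle `μ` of degree `n + 1`, where `n ≥ 1`: one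
generator `b` in degree `n` with `d b = μ` is added. -/
def extension (hn : 1 ≤ n) (hμ : g.IsCocycle (n + 1) μ) : SuperLInfinityAlgebra :=
  ofGen (g.extensionDeg n)
    (by rintro (x | x); exacts [g.one_le_deg x, hn])
    (fun k => by
      refine (((g.finite_type k).image Sum.inl).union (Set.toFinite (Set.range Sum.inr))).subset ?_
      rintro (x | x) hx
      exacts [Or.inl ⟨x, hx, rfl⟩, Or.inr ⟨x, rfl⟩])
    (g.extensionDiff n μ) (g.extensionDiff_mem hμ) (by
      rintro (x | x)
      · exact (g.derivation_extensionIncl hμ _).trans (by rw [g.d_d, map_zero])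
      · exact (g.derivation_extensionIncl hμ _).trans (by rw [hμ.2, map_zero]))

variable {g} (hn : 1 ≤ n) (hμ : g.IsCocycle (n + 1) μ)

/-- The generators of the extension that come from `g`. -/
def extensionInl (x : g.Gen) : (g.extension hn hμ).Gen :=
  (Sum.inl x : g.Gen ⊕ Unit)

/-- The new generator of the extension. -/
def extensionNew : (g.extension hn hμ).Gen :=
  (Sum.inr () : g.Gen ⊕ Unit)

theorem extension_gen_cases {C : (g.extension hn hμ).Gen → Prop}
    (inl : ∀ x, C (extensionInl hn hμ x)) (new : C (extensionNew hn hμ))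
    (y : (g.extension hn hμ).Gen) : C y := by
  rcases y with x | x
  exacts [inl x, new]

/-- The projection from the extension to `g`. -/
def extensionProj : g.extension hn hμ ⟶ g where
  ce := g.extensionIncl n
  ce_mem _ _ ha := g.extensionIncl_mem n ha
  ce_d a := (g.derivation_extensionIncl hμ a).symm

theorem extensionProj_ce_gen (x : g.Gen) : (extensionProj hn hμ).ce (gen g.deg x)
    = gen (g.extension hn hμ).deg (extensionInl hn hμ x) :=
  extensionIncl_gen g n x

theorem extension_d_inl (x : g.Gen) :
    (g.extension hn hμ).d (gen (g.extension hn hμ).deg (extensionInl hn hμ x))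
      = (extensionProj hn hμ).ce (g.d (gen g.deg x)) :=
  derivation_gen (deg := g.extensionDeg n) _ _ _

theorem extension_d_new :
    (g.extension hn hμ).d (gen (g.extension hn hμ).deg (extensionNew hn hμ))
      = (extensionProj hn hμ).ce μ :=
  derivation_gen (deg := g.extensionDeg n) _ _ _

theorem extensionNew_mem : gen (g.extension hn hμ).deg (extensionNew hn hμ) ∈
    homog (g.extension hn hμ).deg (n, 0) :=
  gen_mem (extensionNew hn hμ)

/-- The values on generators of a homomorphism into the extension. -/
def extensionLiftGen {k : SuperLInfinityAlgebra} (f : k ⟶ g) (b : k.CE) :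
    (g.extension hn hμ).Gen → k.CE :=
  Sum.elim (fun x => f.ce (gen g.deg x)) fun _ => b

theorem extensionLiftGen_mem {k : SuperLInfinityAlgebra} (f : k ⟶ g) {b : k.CE}
    (hb : b ∈ homog k.deg (n, 0)) (y : (g.extension hn hμ).Gen) :
    extensionLiftGen hn hμ f b y ∈ homog k.deg ((g.extension hn hμ).deg y) := by
  revert y
  refine extension_gen_cases hn hμ (fun x => f.ce_mem _ _ (gen_mem x)) hb

/-- Stated for the bare algebra homomorphism, because it is needed to check that this homomorphism
respects the differentials. -/
theorem lift_extensionLiftGen {k : SuperLInfinityAlgebra} (f : k ⟶ g) {b : k.CE}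
    (hb : b ∈ homog k.deg (n, 0)) (a : g.CE) :
    lift (deg := (g.extension hn hμ).deg) (extensionLiftGen hn hμ f b)
      (fun x y => homog_mul_comm (extensionLiftGen_mem hn hμ f hb x)
        (extensionLiftGen_mem hn hμ f hb y)) ((extensionProj hn hμ).ce a) = f.ce a := by
  refine DFunLike.congr_fun (f := (lift (deg := (g.extension hn hμ).deg) _ _).comp
    (extensionProj hn hμ).ce) (algHom_ext fun x => ?_) a
  rw [AlgHom.comp_apply, extensionProj_ce_gen, lift_gen]
  rfl

/-- The universal property of the extension: homomorphisms into it are homomorphisms to `g` with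
a trivialization of the pulled back cocycle. -/
def extensionLift {k : SuperLInfinityAlgebra} (f : k ⟶ g) (b : k.CE) (hb : b ∈ homog k.deg (n, 0))
    (hdb : k.d b = f.ce μ) : k ⟶ g.extension hn hμ :=
  homOfGen (extensionLiftGen hn hμ f b) (extensionLiftGen_mem hn hμ f hb)
    (extension_gen_cases hn hμ
      (fun x => by
        rw [extension_d_inl, lift_extensionLiftGen hn hμ f hb]
        exact f.ce_d _)
      (by
        rw [extension_d_new, lift_extensionLiftGen hn hμ f hb]
        exact hdb.symm))

section lift

variable {k : SuperLInfinityAlgebra} (f : k ⟶ g) (b : k.CE)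
  (hb : b ∈ homog k.deg (n, 0)) (hdb : k.d b = f.ce μ)

theorem extensionLift_inl (x : g.Gen) : (extensionLift hn hμ f b hb hdb).ce
    (gen (g.extension hn hμ).deg (extensionInl hn hμ x)) = f.ce (gen g.deg x) :=
  homOfGen_ce_gen (extensionLiftGen hn hμ f b) (extensionLiftGen_mem hn hμ f hb) _ _

theorem extensionLift_new : (extensionLift hn hμ f b hb hdb).ce
    (gen (g.extension hn hμ).deg (extensionNew hn hμ)) = b :=
  homOfGen_ce_gen (extensionLiftGen hn hμ f b) (extensionLiftGen_mem hn hμ f hb) _ _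

theorem extensionLift_proj : extensionLift hn hμ f b hb hdb ≫ extensionProj hn hμ = f :=
  hom_ext fun x => by rw [comp_ce, extensionProj_ce_gen, extensionLift_inl]

end lift

theorem extension_hom_ext {k : SuperLInfinityAlgebra} {f f' : k ⟶ g.extension hn hμ}
    (h : f ≫ extensionProj hn hμ = f' ≫ extensionProj hn hμ)
    (hb : f.ce (gen (g.extension hn hμ).deg (extensionNew hn hμ))
      = f'.ce (gen (g.extension hn hμ).deg (extensionNew hn hμ))) : f = f' := by
  refine hom_ext (extension_gen_cases hn hμ (fun x => ?_) hb)
  have := congrArg (fun u : k ⟶ g => u.ce (gen g.deg x)) h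
  simpa only [comp_ce, extensionProj_ce_gen] using this

end extension

/-! ## The path fibration over the line -/

/-- The generator of `CE(ℝ[n])`. -/
def lineGen (n : ℕ) : (line n).Gen := ()

theorem eq_lineGen {n : ℕ} (x : (line n).Gen) : x = lineGen n := rfl

theorem line_isCocycle (n : ℕ) : (line n).IsCocycle (n + 1) (gen (line n).deg (lineGen n)) :=
  ⟨gen_mem (deg := (line n).deg) (lineGen n), line_d_gen n _⟩

/-- The contractible extension of `ℝ[n]`, classified by its fundamental cocycle. -/
abbrev linePath {n : ℕ} (hn : 1 ≤ n) : SuperLInfinityAlgebra :=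
  (line n).extension hn (line_isCocycle n)

/-- The fibration from the contractible algebra to the line. -/
abbrev linePathProj {n : ℕ} (hn : 1 ≤ n) : linePath hn ⟶ line n :=
  extensionProj hn (line_isCocycle n)

section pullback

variable {g : SuperLInfinityAlgebra} {n : ℕ} {μ : g.CE} (hn : 1 ≤ n) (hμ : g.IsCocycle (n + 1) μ)

/-- The map from an extension to the path fibration that covers the classifying cocycle. -/
def extensionToPath : g.extension hn hμ ⟶ linePath hn :=
  extensionLift hn (line_isCocycle n) (extensionProj hn hμ ≫ cocycleHom hμ)
    (gen (g.extension hn hμ).deg (extensionNew hn hμ)) (extensionNew_mem hn hμ)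
    (by rw [extension_d_new, comp_ce, cocycleHom_ce_gen])

/-- A homomorphism into the path algebra amounts to an element and its differential. Over `μ` the
differential must be the pulled back `μ`, which leaves precisely the data of `extensionLift`. -/
theorem isPullback_extension :
    IsPullback (extensionProj hn hμ) (extensionToPath hn hμ) (cocycleHom hμ) (linePathProj hn) := by
  have w : extensionProj hn hμ ≫ cocycleHom hμ = extensionToPath hn hμ ≫ linePathProj hn :=
    (extensionLift_proj hn (line_isCocycle n) _ _ _ _).symm
  -- In the path algebra the new generator has differential the generator of the line, which the
  -- cone condition identifies with the pullback of `μ`.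
  have hb (s : Limits.PullbackCone (cocycleHom hμ) (linePathProj hn)) :
      s.pt.d (s.snd.ce (gen (linePath hn).deg (extensionNew hn (line_isCocycle n))))
        = s.fst.ce μ := by
    have h1 := congrArg (fun u : s.pt ⟶ line n => u.ce (gen (line n).deg (lineGen n))) s.condition
    simp only [comp_ce, cocycleHom_ce_gen] at h1
    rw [h1, ← s.snd.ce_d, extension_d_new]
  refine ⟨⟨w⟩, ⟨Limits.PullbackCone.IsLimit.mk w
    (fun s => extensionLift hn hμ s.fst
      (s.snd.ce (gen (linePath hn).deg (extensionNew hn (line_isCocycle n))))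
      (s.snd.ce_mem _ _ (extensionNew_mem hn (line_isCocycle n))) (hb s))
    (fun s => extensionLift_proj hn hμ _ _ _ _) (fun s => ?_) (fun s m h1 h2 => ?_)⟩⟩
  · refine extension_hom_ext hn (line_isCocycle n) ?_ ?_
    · rw [Category.assoc, ← w, ← Category.assoc, extensionLift_proj, s.condition]
    · rw [comp_ce, extensionToPath, extensionLift_new, extensionLift_new]
  · refine extension_hom_ext hn hμ ?_ ?_
    · rw [h1, extensionLift_proj]
    · rw [extensionLift_new, ← h2, comp_ce, extensionToPath, extensionLift_new]

end pullback

theorem linMap_single {g h : SuperLInfinityAlgebra} (f : g ⟶ h) (x : h.Gen) (r : ℝ) :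
    linMap f (Finsupp.single x r) = r • linPart g.deg (f.ce (gen h.deg x)) := by
  simp [linMap]

theorem linDiff_single (g : SuperLInfinityAlgebra) (x : g.Gen) (r : ℝ) :
    g.linDiff (Finsupp.single x r) = r • linPart g.deg (g.d (gen g.deg x)) := by
  simp [linDiff]

/-- Dually, the single generator of the line goes to a generator, so the linear part is injective
without any restriction on degrees. -/
theorem isFibration_linePathProj {n : ℕ} (hn : 1 ≤ n) : IsFibration (linePathProj hn) := by
  intro v _ hv
  have hsingle : v = Finsupp.single (lineGen n) (v (lineGen n)) :=
    Finsupp.ext fun x => by rw [eq_lineGen x, Finsupp.single_eq_same]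
  rw [hsingle, linMap_single, extensionProj_ce_gen, linPart_gen, Finsupp.smul_single_one,
    Finsupp.single_eq_zero] at hv
  rw [hsingle, hv, Finsupp.single_zero]

/-- The augmentation of `CE` of the path algebra, as a homomorphism out of the zero algebra. -/
def zeroToLinePath {n : ℕ} (hn : 1 ≤ n) : zero ⟶ linePath hn :=
  extensionLift hn (line_isCocycle n)
    (cocycleHom (g := zero) (μ := 0) ⟨zero_mem _, map_zero _⟩) 0 (zero_mem _)
    ((map_zero _).trans (cocycleHom_ce_gen _ _).symm)

/-- The linear complex is spanned by `b` and `c` with `b ↦ c`, hence is acyclic. -/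
theorem isWeakEquivalence_zeroToLinePath {n : ℕ} (hn : 1 ≤ n) :
    IsWeakEquivalence (zeroToLinePath hn) := by
  let c := extensionInl hn (line_isCocycle n) (lineGen n)
  let b := extensionNew hn (line_isCocycle n)
  have hcb : c ≠ b := Sum.inl_ne_inr
  have hl : ∀ r : ℝ, (linePath hn).linDiff (Finsupp.single c r) = 0 := fun r => by
    rw [linDiff_single, extension_d_inl, line_d_gen, map_zero, map_zero, smul_zero]
  have hr : ∀ r : ℝ, (linePath hn).linDiff (Finsupp.single b r) = Finsupp.single c r := fun r => by
    rw [linDiff_single, extension_d_new, extensionProj_ce_gen, linPart_gen,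
      Finsupp.smul_single_one]
  have hsum : ∀ u : (linePath hn).Gen →₀ ℝ,
      u = Finsupp.single c (u c) + Finsupp.single b (u b) := fun u => by
    refine Finsupp.ext (extension_gen_cases hn (line_isCocycle n) (fun x => ?_) ?_)
    · change u c = (Finsupp.single c (u c) + Finsupp.single b (u b)) c
      rw [Finsupp.add_apply, Finsupp.single_eq_same, Finsupp.single_eq_of_ne hcb, add_zero]
    · change u b = (Finsupp.single c (u c) + Finsupp.single b (u b)) b
      rw [Finsupp.add_apply, Finsupp.single_eq_same, Finsupp.single_eq_of_ne hcb.symm, zero_add]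
  refine ⟨fun v hv _ => ?_, fun w _ => ⟨0, map_zero _, 0, Finsupp.ext fun x => x.elim⟩⟩
  have h0 : v b = 0 := by
    rwa [hsum v, map_add, hl, hr, zero_add, Finsupp.single_eq_zero] at hv
  refine ⟨Finsupp.single b (v c), ?_⟩
  rw [hr]
  conv_rhs => rw [hsum v, h0, Finsupp.single_zero, add_zero]

/-- With zero linear differentials, cohomology is the whole space of generators. -/
theorem isWeakEquivalence_of_bijective {g h : SuperLInfinityAlgebra} (f : g ⟶ h)
    (hg : g.linDiff = 0) (hh : h.linDiff = 0) (hf : Function.Bijective (linMap f)) :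
    IsWeakEquivalence f := by
  refine ⟨fun v _ hv => ?_, fun w _ => ?_⟩
  · obtain ⟨u, hu⟩ := hv
    rw [hg, LinearMap.zero_apply] at hu
    have : v = 0 := hf.1 (hu.symm.trans (map_zero _).symm)
    rw [this]; exact zero_mem _
  · obtain ⟨v, rfl⟩ := hf.2 w
    exact ⟨v, by rw [hh, LinearMap.zero_apply], by rw [sub_self]; exact zero_mem _⟩

/-- A homomorphism to an extension which is a weak equivalence exhibits its source as the homotopy
fiber of the classifying cocycle. -/
theorem isHomotopyFiber_of_extension {F g : SuperLInfinityAlgebra} {n : ℕ} {μ : g.CE}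
    (hn : 1 ≤ n) (hμ : g.IsCocycle (n + 1) μ) (w : F ⟶ g.extension hn hμ)
    (hw : IsWeakEquivalence w) : IsHomotopyFiber (w ≫ extensionProj hn hμ) (cocycleHom hμ) :=
  ⟨linePath hn, g.extension hn hμ, zeroToLinePath hn, linePathProj hn, extensionProj hn hμ,
    extensionToPath hn hμ, w, isWeakEquivalence_zeroToLinePath hn, isFibration_linePathProj hn,
    isPullback_extension hn hμ, hw, rfl⟩

end SuperLInfinityAlgebra
end
end SuperLInfinity

/-! ### Comparison of the super-Minkowski algebras in dimensions `d + 1` and `d`. -/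

namespace SuperLInfinity
noncomputable section
open FreeSuperComm

namespace MajoranaSpinors

open SuperLInfinityAlgebra

variable {d N : ℕ}

/-- The quadratic element `∑ Q_{αβ} ψ^α ψ^β` of an algebra. -/
def quadratic {B : Type} [Ring B] [Algebra ℝ B] (ψ : Fin N → B) (Q : Matrix (Fin N) (Fin N) ℝ) :
    B :=
  ∑ α, ∑ β, Q α β • (ψ α * ψ β)

section quadratic

variable {B B' : Type} [Ring B] [Algebra ℝ B] [Ring B'] [Algebra ℝ B']

theorem quadratic_smul (ψ : Fin N → B) (r : ℝ) (Q : Matrix (Fin N) (Fin N) ℝ) :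
    quadratic ψ (r • Q) = r • quadratic ψ Q := by
  simp only [quadratic, Matrix.smul_apply, smul_eq_mul, mul_smul, Finset.smul_sum]

theorem map_quadratic (φ : B →ₐ[ℝ] B') (ψ : Fin N → B) (Q : Matrix (Fin N) (Fin N) ℝ) :
    φ (quadratic ψ Q) = quadratic (fun α => φ (ψ α)) Q := by
  simp only [quadratic, map_sum, map_smul, map_mul]

/-- Linear substitution of the variables. -/
theorem quadratic_substitute (ψ : Fin N → B) (A Q : Matrix (Fin N) (Fin N) ℝ) :
    quadratic (fun α => ∑ β, A α β • ψ β) Q = quadratic ψ (A.transpose * Q * A) := by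
  have h1 : ∀ α β, Q α β • ((∑ γ, A α γ • ψ γ) * ∑ δ, A β δ • ψ δ)
      = ∑ γ, ∑ δ, (A α γ * Q α β * A β δ) • (ψ γ * ψ δ) := fun α β => by
    simp only [Finset.sum_mul_sum, smul_mul_smul_comm, Finset.smul_sum, smul_smul]
    refine Finset.sum_congr rfl fun γ _ => Finset.sum_congr rfl fun δ _ => ?_
    congr 1
    ring
  have h2 : ∀ γ δ, (A.transpose * Q * A) γ δ = ∑ α, ∑ β, A α γ * Q α β * A β δ := fun γ δ => by
    simp only [Matrix.mul_apply, Finset.sum_mul, Matrix.transpose_apply]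
    exact Finset.sum_comm
  simp only [quadratic, h1, h2, Finset.sum_smul]
  calc ∑ α, ∑ β, ∑ γ, ∑ δ, (A α γ * Q α β * A β δ) • (ψ γ * ψ δ)
      = ∑ α, ∑ γ, ∑ β, ∑ δ, (A α γ * Q α β * A β δ) • (ψ γ * ψ δ) :=
        Finset.sum_congr rfl fun α _ => Finset.sum_comm
    _ = ∑ γ, ∑ α, ∑ β, ∑ δ, (A α γ * Q α β * A β δ) • (ψ γ * ψ δ) := Finset.sum_comm
    _ = ∑ γ, ∑ α, ∑ δ, ∑ β, (A α γ * Q α β * A β δ) • (ψ γ * ψ δ) :=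
        Finset.sum_congr rfl fun γ _ => Finset.sum_congr rfl fun α _ => Finset.sum_comm
    _ = ∑ γ, ∑ δ, ∑ α, ∑ β, (A α γ * Q α β * A β δ) • (ψ γ * ψ δ) :=
        Finset.sum_congr rfl fun γ _ => Finset.sum_comm

theorem linPart_quadratic {X : Type} {deg : X → ℕ × ZMod 2} (x : Fin N → X)
    (Q : Matrix (Fin N) (Fin N) ℝ) :
    linPart deg (quadratic (fun α => gen deg (x α)) Q) = 0 := by
  simp [quadratic]

end quadratic

/-- The generator `e^a`. -/
def vec (S : MajoranaSpinors d N) (a : Fin d) : S.superMinkowski.Gen :=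
  (Sum.inl a : Fin d ⊕ Fin N)

/-- The generator `ψ^α`. -/
def spin (S : MajoranaSpinors d N) (α : Fin N) : S.superMinkowski.Gen :=
  (Sum.inr α : Fin d ⊕ Fin N)

/-- `∑ Q_{αβ} ψ^α ∧ ψ^β` in the Chevalley-Eilenberg algebra of super-Minkowski spacetime. -/
def form (S : MajoranaSpinors d N) (Q : Matrix (Fin N) (Fin N) ℝ) : S.superMinkowski.CE :=
  quadratic (fun α => gen S.superMinkowski.deg (S.spin α)) Q

theorem map_form (S : MajoranaSpinors d N) {B : Type} [Ring B] [Algebra ℝ B]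
    (φ : S.superMinkowski.CE →ₐ[ℝ] B) (Q : Matrix (Fin N) (Fin N) ℝ) :
    φ (S.form Q) = quadratic (fun α => φ (gen S.superMinkowski.deg (S.spin α))) Q :=
  map_quadratic _ _ _

/-- Any quadratic expression in the closed generators `ψ^α` is closed; no Fierz identity is
involved. -/
theorem isCocycle_form (S : MajoranaSpinors d N) (M : Matrix (Fin N) (Fin N) ℝ) :
    S.superMinkowski.IsCocycle 2 (S.form (S.C * M)) :=
  ⟨S.bilin_mem M, S.derivation_bilin M⟩

theorem superMinkowski_gen_cases (S : MajoranaSpinors d N) {P : S.superMinkowski.Gen → Prop}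
    (vec : ∀ a, P (S.vec a)) (spin : ∀ α, P (S.spin α)) (x : S.superMinkowski.Gen) : P x := by
  rcases x with a | α
  exacts [vec a, spin α]

theorem superMinkowski_d_vec (S : MajoranaSpinors d N) (a : Fin d) :
    S.superMinkowski.d (gen S.superMinkowski.deg (S.vec a)) = S.form (S.C * S.Γ a) :=
  derivation_gen (deg := genDeg d N) S.genDiff S.genDiff_mem (Sum.inl a)

theorem superMinkowski_d_spin (S : MajoranaSpinors d N) (α : Fin N) :
    S.superMinkowski.d (gen S.superMinkowski.deg (S.spin α)) = 0 :=
  derivation_gen (deg := genDeg d N) S.genDiff S.genDiff_mem (Sum.inr α)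

/-- The differential is purely quadratic on generators: there is no unary bracket. -/
theorem superMinkowski_linDiff (S : MajoranaSpinors d N) : S.superMinkowski.linDiff = 0 := by
  refine Finsupp.lhom_ext (S.superMinkowski_gen_cases (fun a r => ?_) (fun α r => ?_))
  · rw [linDiff_single, superMinkowski_d_vec, form, linPart_quadratic, smul_zero,
      LinearMap.zero_apply]
  · rw [linDiff_single, superMinkowski_d_spin, map_zero, smul_zero, LinearMap.zero_apply]

theorem extension_form_linDiff (S : MajoranaSpinors d N) (M : Matrix (Fin N) (Fin N) ℝ) :
    (S.superMinkowski.extension le_rfl (S.isCocycle_form M)).linDiff = 0 := by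
  have hform : ∀ Q, linPart (S.superMinkowski.extension le_rfl (S.isCocycle_form M)).deg
      ((extensionProj le_rfl (S.isCocycle_form M)).ce (S.form Q)) = 0 := fun Q => by
    rw [map_form]
    simp only [extensionProj_ce_gen]
    rw [linPart_quadratic]
  refine Finsupp.lhom_ext (extension_gen_cases le_rfl (S.isCocycle_form M)
    (S.superMinkowski_gen_cases (fun a t => ?_) (fun α t => ?_)) (fun t => ?_))
  · rw [linDiff_single, extension_d_inl, superMinkowski_d_vec, hform, smul_zero,
      LinearMap.zero_apply]
  · rw [linDiff_single, extension_d_inl, superMinkowski_d_spin, map_zero, map_zero, smul_zero,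
      LinearMap.zero_apply]
  · rw [linDiff_single, extension_d_new, hform, smul_zero, LinearMap.zero_apply]

section reduction

variable (S : MajoranaSpinors d N) (T : MajoranaSpinors (d + 1) N) (A : Matrix (Fin N) (Fin N) ℝ)
  (r : ℝ)

/-- Values on generators of the dimensional reduction `T → S`. -/
def reductionGen : S.superMinkowski.Gen → T.superMinkowski.CE :=
  Sum.elim (fun a => r • gen T.superMinkowski.deg (T.vec a.castSucc))
    fun α => ∑ β, A α β • gen T.superMinkowski.deg (T.spin β)

theorem reductionGen_vec (a : Fin d) : reductionGen S T A r (S.vec a)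
    = r • gen T.superMinkowski.deg (T.vec a.castSucc) := rfl

theorem reductionGen_spin (α : Fin N) : reductionGen S T A r (S.spin α)
    = ∑ β, A α β • gen T.superMinkowski.deg (T.spin β) := rfl

theorem reductionGen_mem (x : S.superMinkowski.Gen) :
    reductionGen S T A r x ∈ homog T.superMinkowski.deg (S.superMinkowski.deg x) := by
  revert x
  refine S.superMinkowski_gen_cases (fun a => ?_) (fun α => ?_)
  · rw [reductionGen_vec]
    exact Submodule.smul_mem _ _ (gen_mem (T.vec a.castSucc))
  · rw [reductionGen_spin]
    exact sum_mem fun β _ => Submodule.smul_mem _ _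
      (gen_mem (deg := T.superMinkowski.deg) (T.spin β))

variable {S T A r}

/-- Substituting `A ψ` turns the matrix `C M` into `Aᵀ C M A = (Aᵀ C A) M'`, whose first factor is
`r • T.C`. -/
theorem map_form_of_spin (φ : S.superMinkowski.CE →ₐ[ℝ] T.superMinkowski.CE)
    (hφ : ∀ α, φ (gen S.superMinkowski.deg (S.spin α))
      = ∑ β, A α β • gen T.superMinkowski.deg (T.spin β))
    (hA : A.transpose * S.C * A = r • T.C) {M M' : Matrix (Fin N) (Fin N) ℝ}
    (hM : M * A = A * M') : φ (S.form (S.C * M)) = r • T.form (T.C * M') := by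
  rw [map_form]
  simp only [hφ]
  rw [quadratic_substitute, form, ← quadratic_smul, ← smul_mul_assoc, ← hA]
  simp only [mul_assoc, hM]

/-- The dimensional reduction determined by an equivalence of spinor representations. -/
def reduction (hA : A.transpose * S.C * A = r • T.C)
    (hAΓ : ∀ a, S.Γ a * A = A * T.Γ a.castSucc) : T.superMinkowski ⟶ S.superMinkowski :=
  homOfGen (reductionGen S T A r) (reductionGen_mem S T A r)
    (S.superMinkowski_gen_cases
      (fun a => by
        rw [superMinkowski_d_vec, map_form_of_spin (lift _ _) (fun α => lift_gen _ _ _) hA (hAΓ a),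
          reductionGen_vec, map_smul, superMinkowski_d_vec])
      (fun α => by
        rw [superMinkowski_d_spin, map_zero, reductionGen_spin, map_sum]
        simp only [map_smul, superMinkowski_d_spin, smul_zero, Finset.sum_const_zero]))

variable (hA : A.transpose * S.C * A = r • T.C) (hAΓ : ∀ a, S.Γ a * A = A * T.Γ a.castSucc)

theorem reduction_vec (a : Fin d) : (reduction hA hAΓ).ce (gen S.superMinkowski.deg (S.vec a))
    = r • gen T.superMinkowski.deg (T.vec a.castSucc) :=
  homOfGen_ce_gen (reductionGen S T A r) (reductionGen_mem S T A r) _ _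

theorem reduction_spin (α : Fin N) : (reduction hA hAΓ).ce (gen S.superMinkowski.deg (S.spin α))
    = ∑ β, A α β • gen T.superMinkowski.deg (T.spin β) :=
  homOfGen_ce_gen (reductionGen S T A r) (reductionGen_mem S T A r) _ _

variable {M : Matrix (Fin N) (Fin N) ℝ} {c : ℝ} (hM : M * A = A * (c • T.Γ (Fin.last d)))

/-- The lift of the dimensional reduction to the extension classified by `ψ̄ ∧ M ψ`, when `M`
corresponds to a multiple of the last Clifford generator. -/
def reductionLift : T.superMinkowski ⟶ S.superMinkowski.extension le_rfl (S.isCocycle_form M) :=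
  extensionLift le_rfl (S.isCocycle_form M) (reduction hA hAΓ)
    -- `d b = ψ̄ ∧ M ψ` pulls back to `r` times the form of `c • T.Γ (Fin.last d)`, which is `r * c`
    -- times the differential of the last vector generator.
    ((r * c) • gen T.superMinkowski.deg (T.vec (Fin.last d)))
    (Submodule.smul_mem _ _ (gen_mem (T.vec (Fin.last d)))) (by
      rw [map_smul, superMinkowski_d_vec, map_form_of_spin _ (reduction_spin hA hAΓ) hA hM,
        form, form, mul_smul_comm, quadratic_smul, smul_smul])

theorem linMap_reductionLift_surjective (hr : r ≠ 0) (hc : c ≠ 0) (hA' : IsUnit A) :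
    Function.Surjective (linMap (reductionLift hA hAΓ hM)) := by
  have key : ∀ x : T.superMinkowski.Gen,
      Finsupp.single x (1 : ℝ) ∈ LinearMap.range (linMap (reductionLift hA hAΓ hM)) := by
    refine T.superMinkowski_gen_cases (fun a => ?_) fun β => ?_
    · induction a using Fin.lastCases with
      | last =>
        refine ⟨Finsupp.single (extensionNew le_rfl (S.isCocycle_form M)) (r * c)⁻¹, ?_⟩
        rw [linMap_single, reductionLift, extensionLift_new, map_smul, linPart_gen,
          inv_smul_smul₀ (mul_ne_zero hr hc)]
      | cast a =>
        refine ⟨Finsupp.single (extensionInl le_rfl (S.isCocycle_form M) (S.vec a)) r⁻¹, ?_⟩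
        rw [linMap_single, reductionLift, extensionLift_inl, reduction_vec, map_smul, linPart_gen,
          inv_smul_smul₀ hr]
    -- Row `β` of a left inverse of `A` gives the combination of the old spinor generators that maps
    -- to `ψ^β`.
    · obtain ⟨B, hB⟩ := hA'.exists_left_inv
      refine ⟨∑ α, Finsupp.single (extensionInl le_rfl (S.isCocycle_form M) (S.spin α)) (B β α), ?_⟩
      simp only [map_sum, linMap_single, reductionLift, extensionLift_inl, reduction_spin, map_smul,
        linPart_gen, Finset.smul_sum, smul_smul]
      rw [Finset.sum_comm]
      simp only [← Finset.sum_smul, ← Matrix.mul_apply, hB]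
      rw [Finset.sum_eq_single β (fun γ _ h => by rw [Matrix.one_apply_ne' h, zero_smul])
        (fun h => absurd (Finset.mem_univ β) h), Matrix.one_apply_eq, one_smul]
  intro v
  induction v using Finsupp.induction_linear with
  | zero => exact ⟨0, map_zero _⟩
  | add v w hv hw =>
    obtain ⟨v, rfl⟩ := hv
    obtain ⟨w, rfl⟩ := hw
    exact ⟨v + w, map_add _ _ _⟩
  | single x t =>
    obtain ⟨v, hv⟩ := key x
    exact ⟨t • v, by rw [map_smul, hv, Finsupp.smul_single_one]⟩

/-- Both sides have `d + 1 + N` generators, `b` replacing the missing vector direction, so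
surjectivity of the linear part already makes it bijective. -/
theorem isWeakEquivalence_reductionLift (hr : r ≠ 0) (hc : c ≠ 0) (hA' : IsUnit A) :
    IsWeakEquivalence (reductionLift hA hAΓ hM) := by
  have hsurj := linMap_reductionLift_surjective hA hAΓ hM hr hc hA'
  refine isWeakEquivalence_of_bijective _ T.superMinkowski_linDiff (S.extension_form_linDiff M)
    ⟨?_, hsurj⟩
  have hrank : Module.finrank ℝ ((Fin d ⊕ Fin N) ⊕ Unit →₀ ℝ)
      = Module.finrank ℝ (Fin (d + 1) ⊕ Fin N →₀ ℝ) := by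
    simp only [Module.finrank_finsupp_self, Fintype.card_sum, Fintype.card_fin, Fintype.card_unit]
    omega
  exact (LinearMap.injective_iff_surjective_of_finrank_eq_finrank hrank).2 hsurj

end reduction

end MajoranaSpinors
end
end SuperLInfinity

theorem proposition4p5 (S₁₀ : SuperLInfinity.MajoranaSpinors 10 32)
    (S₁₁ : SuperLInfinity.MajoranaSpinors 11 32) :
    ∃ (hμ : S₁₀.superMinkowski.IsCocycle 2 S₁₀.d0Cocycle)
      (p : S₁₁.superMinkowski ⟶ S₁₀.superMinkowski),
      SuperLInfinity.SuperLInfinityAlgebra.IsHomotopyFiber p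
        (SuperLInfinity.SuperLInfinityAlgebra.cocycleHom (n := 1) hμ) := by
  obtain ⟨A, r, hA, hr, hAΓ, hAC⟩ := S₁₀.exists_equivalence S₁₁.reduce (by decide) (by norm_num)
  obtain ⟨c, hc, hχ⟩ := S₁₁.exists_chirality_reduce (by decide) (by norm_num)
  -- `A` carries the product of the ten `S₁₀.Γ a` to that of the reduced `S₁₁`, which is `c` times
  -- the eleventh generator.
  have hM : S₁₀.chirality * A = A * (c • S₁₁.Γ (Fin.last 10)) := by
    rw [← hχ, SuperLInfinity.MajoranaSpinors.chirality, SuperLInfinity.MajoranaSpinors.chirality,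
      List.ofFn_eq_map, List.ofFn_eq_map]
    exact SuperLInfinity.list_prod_mul_of_intertwine hAΓ _
  -- The homomorphism left to unification is the lift to the extension followed by its projection.
  -- Here `n = 1`, which is why `1 ≤ n` is `le_rfl`.
  exact ⟨S₁₀.isCocycle_form S₁₀.chirality, _,
    SuperLInfinity.SuperLInfinityAlgebra.isHomotopyFiber_of_extension le_rfl _ _
      (SuperLInfinity.MajoranaSpinors.isWeakEquivalence_reductionLift hAC hAΓ hM hr hc hA)⟩
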